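/- Let $n\in\mathbb N$ and $\Bbbk=(k_1,\dots,k_n)\in\mathbb N^n$. Put $\phi(z)=|z|^2/4$ on $\mathbb C^n$, let $\mathcal F(\mathbb C^n)$ be the Fock space of entire functions $f$ with $e^{-\phi}f\in L^2(\mathbb C^n)$, and let $\mathcal L_0=e^{-\phi}\mathcal F(\mathbb C^n)$. With the creation operators $q_j^*=-2\,\partial/\partial z_j+\tfrac12\bar z_j$, let $$\mathcal L_{\Bbbk}=(q_1^*)^{k_1}\cdots(q_n^*)^{k_n}\mathcal L_0\subseteq L^2(\mathbb C^n)$$ (a closed subspace) be the particular Landau level of height $\Bbbk$, and let $P_{\Bbbk}$ be the orthogonal projection of $L^2(\mathbb C^n)$ onto $\mathcal L_{\Bbbk}$. For $a\in C_b(\mathbb C^n)$ (bounded continuous complex functions) let $\pi(a)$ be the operator of multiplication by $a$ on $L^2(\mathbb C^n)$ and let $T_{\Bbbk}(a)=P_{\Bbbk}\pi(a)|_{\mathcal L_{\Bbbk}}\in\mathcal B(\mathcal L_{\Bbbk})$. Let $A\subseteq C_b(\mathbb C^n)$ be the $*$-subalgebra of those $a$ for which $v\mapsto a(rv)$ converges,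 as $r\to\infty$, uniformly on the unit sphere $S^{2n-1}$ to a continuous function on $S^{2n-1}$. Then the commutator $[P_{\Bbbk},\pi(a)]$ is a compact operator on $L^2(\mathbb C^n)$ for every $a\in A$. Moreover the linear map $T_{\Bbbk}:A\to\mathcal B(\mathcal L_{\Bbbk})$ satisfies $T_{\Bbbk}(\bar a)=T_{\Bbbk}(a)^*$ for all $a\in A$, and $T_{\Bbbk}(ab)-T_{\Bbbk}(a)T_{\Bbbk}(b)$ is a compact operator on $\mathcal L_{\Bbbk}$ for all $a,b\in A$. -/

import Mathlib

open MeasureTheory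
open scoped ContDiff BoundedContinuousFunction

noncomputable section

namespace LandauLevels

/-- The space `ℂⁿ` with its Euclidean norm; `volume` on it is Lebesgue measure. -/
abbrev Cn (n : ℕ) : Type := EuclideanSpace ℂ (Fin n)

/-- The Hilbert space `L²(ℂⁿ)`. -/
abbrev L2Cn (n : ℕ) : Type := Lp ℂ 2 (volume : Measure (Cn n))

/-! ### Landau levels -/

/-- The Wirtinger derivative `∂u/∂z_j = (∂u/∂x_j - i ∂u/∂y_j) / 2`. -/
def wirtinger {n : ℕ} (j : Fin n) (u : Cn n → ℂ) (z : Cn n) : ℂ :=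
  (fderiv ℝ u z (EuclideanSpace.single j (1 : ℂ)) -
    Complex.I * fderiv ℝ u z (EuclideanSpace.single j Complex.I)) / 2

/-- The creation operator `q_j^* = -2 ∂/∂z_j + conj z_j / 2`. -/
def creation {n : ℕ} (j : Fin n) (u : Cn n → ℂ) (z : Cn n) : ℂ :=
  -2 * wirtinger j u z + (starRingEnd ℂ) (z j) / 2 * u z

/-- `q_𝕜^* = (q_1^*)^{k_1} ⋯ (q_n^*)^{k_n}`. -/
def creationPow {n : ℕ} (k : Fin n → ℕ) (u : Cn n → ℂ) : Cn n → ℂ :=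
  (List.finRange n).foldr (fun j v => (creation j)^[k j] v) u

/-- The function `e^{-φ} f` with `φ(z) = |z|² / 4`. -/
def gaussianMul {n : ℕ} (f : Cn n → ℂ) (z : Cn n) : ℂ :=
  (Real.exp (-(‖z‖ ^ 2 / 4)) : ℂ) * f z

/-- The Fock space `F(ℂⁿ) = L²(ℂⁿ, e^{-2φ}) ∩ O(ℂⁿ)` : entire functions `f` with
`e^{-φ} f` square integrable. -/
def IsFock {n : ℕ} (f : Cn n → ℂ) : Prop :=
  AnalyticOnNhd ℂ f Set.univ ∧ MemLp (gaussianMul f) 2 (volume : Measure (Cn n))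

theorem wirtinger_add {n : ℕ} (j : Fin n) {u v : Cn n → ℂ}
    (hu : ContDiff ℝ ∞ u) (hv : ContDiff ℝ ∞ v) :
    wirtinger j (u + v) = wirtinger j u + wirtinger j v := by
  funext z
  have h1 : DifferentiableAt ℝ u z := (hu.differentiable (by simp)) z
  have h2 : DifferentiableAt ℝ v z := (hv.differentiable (by simp)) z
  simp only [wirtinger, Pi.add_apply, fderiv_add h1 h2, add_apply]
  ring

theorem wirtinger_smul {n : ℕ} (j : Fin n) (c : ℂ) {u : Cn n → ℂ} (hu : ContDiff ℝ ∞ u) :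
    wirtinger j (c • u) = c • wirtinger j u := by
  funext z
  have h1 : DifferentiableAt ℝ u z := (hu.differentiable (by simp)) z
  simp only [wirtinger, Pi.smul_apply, fderiv_const_smul h1, smul_apply, smul_eq_mul]
  ring

theorem contDiff_creation {n : ℕ} (j : Fin n) {u : Cn n → ℂ} (hu : ContDiff ℝ ∞ u) :
    ContDiff ℝ ∞ (creation j u) := by
  have hd : ContDiff ℝ ∞ (fderiv ℝ u) := hu.fderiv_right (by simp)
  have hc : ContDiff ℝ ∞ (fun z : Cn n => (starRingEnd ℂ) (z j)) :=
    Complex.conjCLE.contDiff.comp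
      (((EuclideanSpace.proj j : Cn n →L[ℂ] ℂ).restrictScalars ℝ).contDiff)
  unfold creation wirtinger
  fun_prop

theorem creation_add {n : ℕ} (j : Fin n) {u v : Cn n → ℂ}
    (hu : ContDiff ℝ ∞ u) (hv : ContDiff ℝ ∞ v) :
    creation j (u + v) = creation j u + creation j v := by
  funext z
  simp only [creation, wirtinger_add j hu hv, Pi.add_apply]
  ring

theorem creation_smul {n : ℕ} (j : Fin n) (c : ℂ) {u : Cn n → ℂ} (hu : ContDiff ℝ ∞ u) :
    creation j (c • u) = c • creation j u := by
  funext z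
  simp only [creation, wirtinger_smul j c hu, Pi.smul_apply, smul_eq_mul]
  ring

theorem contDiff_creation_iterate {n : ℕ} (j : Fin n) (m : ℕ) {u : Cn n → ℂ}
    (hu : ContDiff ℝ ∞ u) : ContDiff ℝ ∞ ((creation j)^[m] u) := by
  induction m with
  | zero => exact hu
  | succ m ih =>
    rw [Function.iterate_succ_apply']
    exact contDiff_creation j ih

theorem creation_iterate_add {n : ℕ} (j : Fin n) (m : ℕ) {u v : Cn n → ℂ}
    (hu : ContDiff ℝ ∞ u) (hv : ContDiff ℝ ∞ v) :
    (creation j)^[m] (u + v) = (creation j)^[m] u + (creation j)^[m] v := by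
  induction m with
  | zero => rfl
  | succ m ih =>
    simp only [Function.iterate_succ_apply', ih]
    exact creation_add j (contDiff_creation_iterate j m hu) (contDiff_creation_iterate j m hv)

theorem creation_iterate_smul {n : ℕ} (j : Fin n) (m : ℕ) (c : ℂ) {u : Cn n → ℂ}
    (hu : ContDiff ℝ ∞ u) :
    (creation j)^[m] (c • u) = c • (creation j)^[m] u := by
  induction m with
  | zero => rfl
  | succ m ih =>
    simp only [Function.iterate_succ_apply', ih]
    exact creation_smul j c (contDiff_creation_iterate j m hu)

theorem contDiff_foldr {n : ℕ} (k : Fin n → ℕ) (l : List (Fin n)) {u : Cn n → ℂ}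
    (hu : ContDiff ℝ ∞ u) :
    ContDiff ℝ ∞ (l.foldr (fun j v => (creation j)^[k j] v) u) := by
  induction l with
  | nil => exact hu
  | cons j l ih => exact contDiff_creation_iterate j (k j) ih

theorem creationPow_add {n : ℕ} (k : Fin n → ℕ) {u v : Cn n → ℂ}
    (hu : ContDiff ℝ ∞ u) (hv : ContDiff ℝ ∞ v) :
    creationPow k (u + v) = creationPow k u + creationPow k v := by
  unfold creationPow
  induction List.finRange n with
  | nil => rfl
  | cons j l ih =>
    simp only [List.foldr_cons, ih]
    exact creation_iterate_add j (k j) (contDiff_foldr k l hu) (contDiff_foldr k l hv)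

theorem creationPow_smul {n : ℕ} (k : Fin n → ℕ) (c : ℂ) {u : Cn n → ℂ}
    (hu : ContDiff ℝ ∞ u) :
    creationPow k (c • u) = c • creationPow k u := by
  unfold creationPow
  induction List.finRange n with
  | nil => rfl
  | cons j l ih =>
    simp only [List.foldr_cons, ih]
    exact creation_iterate_smul j (k j) c (contDiff_foldr k l hu)

theorem gaussianMul_add {n : ℕ} (f g : Cn n → ℂ) :
    gaussianMul (f + g) = gaussianMul f + gaussianMul g := by
  funext z
  simp only [gaussianMul, Pi.add_apply]
  ring

theorem gaussianMul_smul {n : ℕ} (c : ℂ) (f : Cn n → ℂ) :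
    gaussianMul (c • f) = c • gaussianMul f := by
  funext z
  simp only [gaussianMul, Pi.smul_apply, smul_eq_mul]
  ring

theorem IsFock.contDiff {n : ℕ} {f : Cn n → ℂ} (hf : IsFock f) :
    ContDiff ℝ ∞ (gaussianMul f) := by
  have h1 : ContDiff ℂ ∞ f := contDiffOn_univ.1 (hf.1.contDiffOn uniqueDiffOn_univ)
  have h2 : ContDiff ℝ ∞ f := h1.restrict_scalars ℝ
  have h3 : ContDiff ℝ ∞ (fun z : Cn n => (Real.exp (-(‖z‖ ^ 2 / 4)) : ℂ)) :=
    Complex.ofRealCLM.contDiff.comp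
      (Real.contDiff_exp.comp ((contDiff_norm_sq ℝ).div_const 4).neg)
  exact h3.mul h2

/-- The subspace `q_𝕜^* L_0` of `L²(ℂⁿ)`, where `L_0 = e^{-φ} F(ℂⁿ)`. -/
def landauSpace (n : ℕ) (k : Fin n → ℕ) : Submodule ℂ (L2Cn n) where
  carrier := {u | ∃ f : Cn n → ℂ, IsFock f ∧ u =ᵐ[volume] creationPow k (gaussianMul f)}
  add_mem' := by
    rintro u v ⟨f, hf, hu⟩ ⟨g, hg, hv⟩
    refine ⟨f + g, ⟨hf.1.add hg.1, ?_⟩, ?_⟩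
    · rw [gaussianMul_add]
      exact hf.2.add hg.2
    · rw [gaussianMul_add, creationPow_add k hf.contDiff hg.contDiff]
      exact (Lp.coeFn_add u v).trans (hu.add hv)
  zero_mem' := by
    have h0 : IsFock (0 : Cn n → ℂ) := by
      refine ⟨analyticOnNhd_const, ?_⟩
      have : gaussianMul (0 : Cn n → ℂ) = 0 := by
        funext z
        simp [gaussianMul]
      rw [this]
      exact MemLp.zero
    refine ⟨0, h0, ?_⟩
    have h1 := creationPow_smul k 0 h0.contDiff
    rw [← gaussianMul_smul, zero_smul, zero_smul] at h1
    rw [h1]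
    exact Lp.coeFn_zero ℂ 2 volume
  smul_mem' := by
    rintro c u ⟨f, hf, hu⟩
    refine ⟨c • f, ⟨hf.1.const_smul, ?_⟩, ?_⟩
    · rw [gaussianMul_smul]
      exact hf.2.const_smul c
    · rw [gaussianMul_smul, creationPow_smul k c hf.contDiff]
      exact (Lp.coeFn_smul c u).trans (hu.const_smul c)

/-- The particular Landau level `L_𝕜` of height `𝕜`. The space `q_𝕜^* L_0` is in fact closed
(`q_𝕜^*` is a multiple of an isometry on `L_0`), so taking the closure changes nothing; it makes
completeness, hence the orthogonal projection, available by construction. -/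
def landauLevel (n : ℕ) (k : Fin n → ℕ) : Submodule ℂ (L2Cn n) :=
  (landauSpace n k).topologicalClosure

instance (n : ℕ) (k : Fin n → ℕ) : CompleteSpace (landauLevel n k) :=
  inferInstanceAs (CompleteSpace (landauSpace n k).topologicalClosure)

/-- The orthogonal projection `P_𝕜` of `L²(ℂⁿ)` onto `L_𝕜`, as an operator on `L²(ℂⁿ)`. -/
def landauProj (n : ℕ) (k : Fin n → ℕ) : L2Cn n →L[ℂ] L2Cn n :=
  (landauLevel n k).starProjection

/-! ### Symbols and Toeplitz operators -/

/-- The algebra `A` of bounded continuous functions `a` on `ℂⁿ` such that `v ↦ a (r v)` converges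
uniformly on the unit sphere, as `r → ∞`, to a continuous function. -/
def radialAlgebra (n : ℕ) : StarSubalgebra ℂ (Cn n →ᵇ ℂ) where
  carrier := {a | ∃ b : C(Metric.sphere (0 : Cn n) 1, ℂ),
    TendstoUniformly (fun (r : ℝ) (v : Metric.sphere (0 : Cn n) 1) => a (r • (v : Cn n)))
      b Filter.atTop}
  mul_mem' := by
    rintro a a' ⟨b, hb⟩ ⟨b', hb'⟩
    let F (a : Cn n →ᵇ ℂ) (r : ℝ) : C(Metric.sphere (0 : Cn n) 1, ℂ) :=
      ⟨fun v => a (r • (v : Cn n)), by fun_prop⟩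
    have h := (ContinuousMap.tendsto_iff_tendstoUniformly (F := F a)).2 hb
    have h' := (ContinuousMap.tendsto_iff_tendstoUniformly (F := F a')).2 hb'
    exact ⟨b * b', ContinuousMap.tendsto_iff_tendstoUniformly.1 (h.mul h')⟩
  add_mem' := by
    rintro a a' ⟨b, hb⟩ ⟨b', hb'⟩
    exact ⟨b + b', hb.add hb'⟩
  algebraMap_mem' := by
    intro c
    exact ⟨ContinuousMap.const _ c, fun u hu => Filter.Eventually.of_forall fun r v =>
      by simpa using refl_mem_uniformity hu⟩
  star_mem' := by
    rintro a ⟨b, hb⟩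
    let F (a : Cn n →ᵇ ℂ) (r : ℝ) : C(Metric.sphere (0 : Cn n) 1, ℂ) :=
      ⟨fun v => a (r • (v : Cn n)), by fun_prop⟩
    have h := (ContinuousMap.tendsto_iff_tendstoUniformly (F := F a)).2 hb
    exact ⟨star b, ContinuousMap.tendsto_iff_tendstoUniformly.1 h.star⟩

theorem memLp_mul {n : ℕ} (a : Cn n →ᵇ ℂ) (f : L2Cn n) :
    MemLp (fun z => a z * f z) 2 (volume : Measure (Cn n)) :=
  (Lp.memLp f).of_le_mul (c := ‖a‖)
    (a.continuous.aestronglyMeasurable.mul (Lp.aestronglyMeasurable f))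
    (Filter.Eventually.of_forall fun z => by
      rw [norm_mul]
      exact mul_le_mul_of_nonneg_right (a.norm_coe_le_norm z) (norm_nonneg _))

/-- The operator `π(a)` of multiplication by `a` on `L²(ℂⁿ)`. -/
def mulOp {n : ℕ} (a : Cn n →ᵇ ℂ) : L2Cn n →L[ℂ] L2Cn n :=
  LinearMap.mkContinuous
    { toFun := fun f => (memLp_mul a f).toLp _
      map_add' := by
        intro f g
        rw [← MemLp.toLp_add]
        refine MemLp.toLp_congr _ _ ?_
        filter_upwards [Lp.coeFn_add f g] with z hz
        simp only [hz, Pi.add_apply, mul_add]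
      map_smul' := by
        intro c f
        rw [RingHom.id_apply, ← MemLp.toLp_const_smul]
        refine MemLp.toLp_congr _ _ ?_
        filter_upwards [Lp.coeFn_smul c f] with z hz
        simp only [hz, Pi.smul_apply, smul_eq_mul]
        ring }
    ‖a‖
    (by
      intro f
      refine Lp.norm_le_mul_norm_of_ae_le_mul ?_
      filter_upwards [(memLp_mul a f).coeFn_toLp] with z hz
      simp only [LinearMap.coe_mk, AddHom.coe_mk]
      rw [hz, norm_mul]
      exact mul_le_mul_of_nonneg_right (a.norm_coe_le_norm z) (norm_nonneg _))

theorem coeFn_mulOp {n : ℕ} (a : Cn n →ᵇ ℂ) (f : L2Cn n) :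
    mulOp a f =ᵐ[volume] fun z => a z * f z :=
  (memLp_mul a f).coeFn_toLp

/-- The representation `π` as a linear map `C_b(ℂⁿ) → B(L²(ℂⁿ))`. -/
def multRep (n : ℕ) : (Cn n →ᵇ ℂ) →ₗ[ℂ] (L2Cn n →L[ℂ] L2Cn n) where
  toFun := mulOp
  map_add' := by
    intro a b
    ext1 f
    refine Lp.ext ?_
    rw [add_apply]
    filter_upwards [coeFn_mulOp (a + b) f, coeFn_mulOp a f, coeFn_mulOp b f,
      Lp.coeFn_add (mulOp a f) (mulOp b f)] with z h1 h2 h3 h4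
    rw [h1, h4, Pi.add_apply, h2, h3, BoundedContinuousFunction.add_apply]
    ring
  map_smul' := by
    intro c a
    ext1 f
    refine Lp.ext ?_
    rw [RingHom.id_apply, smul_apply]
    filter_upwards [coeFn_mulOp (c • a) f, coeFn_mulOp a f,
      Lp.coeFn_smul c (mulOp a f)] with z h1 h2 h3
    rw [h1, h3, Pi.smul_apply, h2, BoundedContinuousFunction.smul_apply, smul_eq_mul, smul_eq_mul]
    ring

/-- The linear map `T_𝕜 : C_b(ℂⁿ) → B(L_𝕜)`, `T_𝕜(a) = P_𝕜 π(a)` restricted to `L_𝕜`. -/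
def toeplitz (n : ℕ) (k : Fin n → ℕ) :
    (Cn n →ᵇ ℂ) →ₗ[ℂ] (landauLevel n k →L[ℂ] landauLevel n k) where
  toFun a := (landauLevel n k).orthogonalProjectionOnto ∘L multRep n a ∘L (landauLevel n k).subtypeL
  map_add' := by
    intro a b
    ext1 f
    simp
  map_smul' := by
    intro c a
    ext1 f
    simp

end LandauLevels

end

noncomputable section

namespace LandauLevels

open Filter Topology

/-! ### The torus action -/

/-! The projection `P_k` is an integral operator whose kernel has modulus |κ(w − z)| with κ
integrable. The commutator with multiplication by `a` then has kernel of modulus |κ(w − z)| |a(w) −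
a(z)|. A symbol in A has vanishing oscillation: for fixed R, the supremum of |a(w) − a(z)| over |w −
z| ≤ R tends to 0 as |z| → ∞. Hence the part of the commutator with |z| > M has small norm for large
M (Young's inequality), while the part with |z| ≤ M has a square integrable kernel and is compact.
The commutator is thus a norm limit of compact operators
(`exists_isCompactOperator_near_commutator`), and the semicommutator of Toeplitz operators is a
compression of `a` times a commutator.

The kernel is found by symmetry, without Laguerre polynomials. The torus acts by rotations, and each
rotation intertwines the creation operators up to a character. Averaging an element of the level
over the torus therefore yields a multiple of the single invariant vector q_k^*(e^{-φ} z^k), which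
represents evaluation at 0 (`apply_zero_eq_integral`). Magnetic translations commute with the
creation operators and preserve e^{-φ}F, so they carry this formula to every point
(`IsFock.apply_eq_integral`). The invariant vector is a Gaussian times a function of temperate
growth, so κ is integrable. -/

/-- Coordinatewise multiplication by unimodular numbers. -/
def rot {n : ℕ} (θ : UnitAddTorus (Fin n)) : Cn n ≃ₗᵢ[ℂ] Cn n :=
  LinearIsometryEquiv.piLpCongrRight 2 fun j =>
    { LinearEquiv.smulOfNeZero ℂ ℂ ((θ j).toCircle : ℂ) (Circle.coe_ne_zero _) with
      norm_map' := fun z => by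
        change ‖((θ j).toCircle : ℂ) * z‖ = ‖z‖
        rw [norm_mul, Circle.norm_coe, one_mul] }

theorem rot_apply {n : ℕ} (θ : UnitAddTorus (Fin n)) (z : Cn n) (j : Fin n) :
    rot θ z j = ((θ j).toCircle : ℂ) * z j := rfl

attribute [irreducible] rot

theorem rot_add {n : ℕ} (θ τ : UnitAddTorus (Fin n)) (z : Cn n) :
    rot (θ + τ) z = rot θ (rot τ z) := by
  ext j
  simp [rot_apply, AddCircle.toCircle_add, mul_assoc]

/-- The `j`-th coordinate character of the torus. -/
def coordChar {n : ℕ} (j : Fin n) : C(UnitAddTorus (Fin n), ℂ) :=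
  ⟨fun θ => ((θ j).toCircle : ℂ),
    continuous_subtype_val.comp (AddCircle.continuous_toCircle.comp (continuous_apply j))⟩

theorem continuous_rot {n : ℕ} :
    Continuous fun p : Cn n × UnitAddTorus (Fin n) => rot p.2 p.1 := by
  have h : Continuous fun p : Cn n × UnitAddTorus (Fin n) =>
      (WithLp.toLp 2 fun j => coordChar j p.2 * p.1 j : Cn n) := by
    refine (PiLp.continuous_toLp 2 _).comp (continuous_pi fun j => ?_)
    have h1 : Continuous fun p : Cn n × UnitAddTorus (Fin n) => coordChar j p.2 := by fun_prop
    have h2 : Continuous fun p : Cn n × UnitAddTorus (Fin n) => p.1 j := by fun_prop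
    exact h1.mul h2
  refine h.congr fun p => ?_
  ext j
  rw [rot_apply]
  rfl

theorem continuous_rot_coe {n : ℕ} :
    Continuous fun θ : UnitAddTorus (Fin n) => ((rot θ : Cn n →L[ℂ] Cn n)) := by
  refine continuous_clm_apply.2 fun z => ?_
  exact continuous_rot.comp (Continuous.prodMk_right z)

theorem measurePreserving_rot {n : ℕ} (θ : UnitAddTorus (Fin n)) :
    MeasurePreserving (rot θ : Cn n → Cn n) volume volume :=
  LinearIsometryEquiv.measurePreserving
    ({ (rot θ).toLinearEquiv.restrictScalars ℝ with
        norm_map' := fun z => (rot θ).norm_map z } : Cn n ≃ₗᵢ[ℝ] Cn n)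

/-- Differentiation under an integral over a compact parameter space. -/
theorem hasFDerivAt_integral_of_compact {X E 𝕜 : Type*} [TopologicalSpace X] [CompactSpace X]
    [SecondCountableTopology X] [MeasurableSpace X] [OpensMeasurableSpace X] {μ : Measure X}
    [IsFiniteMeasure μ] [RCLike 𝕜] [NormedAddCommGroup E] [NormedSpace 𝕜 E] [ProperSpace E]
    [NormedSpace 𝕜 ℂ] {F : E → X → ℂ} {F' : E → X → E →L[𝕜] ℂ}
    (hF : ∀ z, Continuous (F z)) (hF' : Continuous fun p : E × X => F' p.1 p.2)
    (h : ∀ x z, HasFDerivAt (fun z => F z x) (F' z x) z) (z : E) :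
    HasFDerivAt (fun z => ∫ x, F z x ∂μ) (∫ x, F' z x ∂μ) z := by
  obtain ⟨C, hC⟩ :=
    ((isCompact_closedBall z 1).prod (isCompact_univ (X := X))).exists_bound_of_continuousOn
      hF'.continuousOn
  refine hasFDerivAt_integral_of_dominated_of_fderiv_le (bound := fun _ => C)
    (Metric.closedBall_mem_nhds z one_pos)
    (Eventually.of_forall fun z => (hF z).aestronglyMeasurable) ?_ ?_ ?_ (integrable_const C) ?_
  · exact (hF z).integrable_of_hasCompactSupport (HasCompactSupport.of_compactSpace _)
  · exact (hF'.comp (Continuous.prodMk_right z)).aestronglyMeasurable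
  · exact Eventually.of_forall fun x w hw => hC (w, x) ⟨hw, Set.mem_univ _⟩
  · exact Eventually.of_forall fun x w _ => h x w

instance : IsProbabilityMeasure (volume : Measure UnitAddCircle) :=
  ⟨UnitAddCircle.measure_univ⟩

/-- The average of the rotates of `u`, weighted by `d`. -/
def torusAvg {n : ℕ} (d : C(UnitAddTorus (Fin n), ℂ)) (u : Cn n → ℂ) (z : Cn n) : ℂ :=
  ∫ θ, d θ * u (rot θ z)

theorem hasFDerivAt_torusAvg_real {n : ℕ} (d : C(UnitAddTorus (Fin n), ℂ)) {u : Cn n → ℂ}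
    (hu : ContDiff ℝ ∞ u) (z : Cn n) :
    HasFDerivAt (torusAvg d u)
      (∫ θ, d θ • (fderiv ℝ u (rot θ z) ∘L (rot θ : Cn n →L[ℂ] Cn n).restrictScalars ℝ)) z := by
  refine hasFDerivAt_integral_of_compact (𝕜 := ℝ) (F := fun z θ => d θ * u (rot θ z))
    (F' := fun z θ =>
      d θ • (fderiv ℝ u (rot θ z) ∘L (rot θ : Cn n →L[ℂ] Cn n).restrictScalars ℝ))
    (fun z => ?_) ?_ (fun θ z => ?_) z
  · exact d.continuous.mul (hu.continuous.comp (continuous_rot.comp (Continuous.prodMk_right z)))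
  · have h1 : Continuous fun p : Cn n × UnitAddTorus (Fin n) => fderiv ℝ u (rot p.2 p.1) :=
      (hu.continuous_fderiv (by simp)).comp continuous_rot
    have h2 : Continuous fun p : Cn n × UnitAddTorus (Fin n) =>
        ((rot p.2 : Cn n →L[ℂ] Cn n).restrictScalars ℝ) :=
      (ContinuousLinearMap.restrictScalarsL ℂ (Cn n) (Cn n) ℝ ℝ).continuous.comp
        (continuous_rot_coe.comp continuous_snd)
    exact (d.continuous.comp continuous_snd).smul (h1.clm_comp h2)
  · have h1 : HasFDerivAt u (fderiv ℝ u (rot θ z)) (rot θ z) :=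
      ((hu.differentiable (by simp)) _).hasFDerivAt
    exact (h1.comp z ((rot θ : Cn n →L[ℂ] Cn n).restrictScalars ℝ).hasFDerivAt).const_mul (d θ)

theorem differentiable_torusAvg {n : ℕ} (d : C(UnitAddTorus (Fin n), ℂ)) {u : Cn n → ℂ}
    (hu : ContDiff ℂ ∞ u) : Differentiable ℂ (torusAvg d u) := by
  intro z
  refine (hasFDerivAt_integral_of_compact (𝕜 := ℂ) (F := fun z θ => d θ * u (rot θ z))
    (F' := fun z θ => d θ • (fderiv ℂ u (rot θ z) ∘L (rot θ : Cn n →L[ℂ] Cn n)))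
    (fun z => ?_) ?_ (fun θ z => ?_) z).differentiableAt
  · exact d.continuous.mul (hu.continuous.comp (continuous_rot.comp (Continuous.prodMk_right z)))
  · have h1 : Continuous fun p : Cn n × UnitAddTorus (Fin n) => fderiv ℂ u (rot p.2 p.1) :=
      (hu.continuous_fderiv (by simp)).comp continuous_rot
    exact (d.continuous.comp continuous_snd).smul
      (h1.clm_comp (continuous_rot_coe.comp continuous_snd))
  · have h1 : HasFDerivAt u (fderiv ℂ u (rot θ z)) (rot θ z) :=
      ((hu.differentiable (by simp)) _).hasFDerivAt
    exact (h1.comp z (rot θ : Cn n →L[ℂ] Cn n).hasFDerivAt).const_mul (d θ)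

theorem rot_single {n : ℕ} (θ : UnitAddTorus (Fin n)) (j : Fin n) (c : ℂ) :
    rot θ (EuclideanSpace.single j c) = EuclideanSpace.single j (coordChar j θ * c) := by
  ext i
  rw [rot_apply]
  by_cases h : i = j
  · subst h
    simp [coordChar]
  · simp [h]

/-- The antilinear part cancels in the Wirtinger derivative. -/
theorem wirtinger_combination {n : ℕ} (L : Cn n →L[ℝ] ℂ) (j : Fin n) (c : ℂ) :
    L (EuclideanSpace.single j (c * 1)) - Complex.I * L (EuclideanSpace.single j (c * Complex.I)) =
      c * (L (EuclideanSpace.single j 1) - Complex.I * L (EuclideanSpace.single j Complex.I)) := by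
  have key : ∀ x : ℂ, L (EuclideanSpace.single j x) =
      x.re * L (EuclideanSpace.single j 1) + x.im * L (EuclideanSpace.single j Complex.I) := by
    intro x
    have : (EuclideanSpace.single j x : Cn n) =
        x.re • EuclideanSpace.single j (1 : ℂ) + x.im • EuclideanSpace.single j Complex.I := by
      ext i
      by_cases h : i = j
      · subst h
        simp [Complex.re_add_im]
      · simp [h]
    rw [this, map_add, map_smul, map_smul]
    simp
  rw [key (c * 1), key (c * Complex.I)]
  apply Complex.ext <;> simp <;> ring

/-- With c the j-th coordinate of the rotation, the chain rule gives ∂/∂z_j the factor c, and conj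
z_j = c · conj (c z_j) because |c| = 1. Both terms of q_j^* thus scale alike. -/
theorem creation_comp_rot {n : ℕ} (j : Fin n) (θ : UnitAddTorus (Fin n)) {u : Cn n → ℂ}
    (hu : ContDiff ℝ ∞ u) (z : Cn n) :
    creation j (u ∘ rot θ) z = coordChar j θ * creation j u (rot θ z) := by
  have h1 : HasFDerivAt u (fderiv ℝ u (rot θ z)) (rot θ z) :=
    ((hu.differentiable (by simp)) _).hasFDerivAt
  have h2 := (h1.comp z ((rot θ : Cn n →L[ℂ] Cn n).restrictScalars ℝ).hasFDerivAt).fderiv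
  have h3 : wirtinger j (u ∘ rot θ) z = coordChar j θ * wirtinger j u (rot θ z) := by
    have h4 := wirtinger_combination (fderiv ℝ u (rot θ z)) j (coordChar j θ)
    rw [← rot_single, ← rot_single] at h4
    have h5 : fderiv ℝ (u ∘ rot θ) z = fderiv ℝ u (rot θ z) ∘L
      (rot θ : Cn n →L[ℂ] Cn n).restrictScalars ℝ := h2
    rw [wirtinger, h5, wirtinger, ← mul_div_assoc, ← h4]
    rfl
  have h6 : coordChar j θ * (starRingEnd ℂ) (rot θ z j) = (starRingEnd ℂ) (z j) := by
    rw [rot_apply, map_mul, ← mul_assoc]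
    change (((θ j).toCircle : ℂ) * (starRingEnd ℂ) ((θ j).toCircle : ℂ)) * _ = _
    rw [Complex.mul_conj, Circle.normSq_coe]
    simp
  rw [creation, creation, h3, ← h6, Function.comp_apply]
  ring

theorem creation_torusAvg {n : ℕ} (j : Fin n) (d : C(UnitAddTorus (Fin n), ℂ)) {u : Cn n → ℂ}
    (hu : ContDiff ℝ ∞ u) :
    creation j (torusAvg d u) = torusAvg (d * coordChar j) (creation j u) := by
  funext z
  have hint : ∀ v : Cn n → ℂ, Continuous v → Integrable fun θ => d θ * v (rot θ z) := by
    intro v hv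
    exact (d.continuous.mul
      (hv.comp (continuous_rot.comp (Continuous.prodMk_right z)))).integrable_of_hasCompactSupport
      (HasCompactSupport.of_compactSpace _)
  have hL : Continuous fun θ => d θ • (fderiv ℝ u (rot θ z) ∘L
      (rot θ : Cn n →L[ℂ] Cn n).restrictScalars ℝ) := by
    have h1 : Continuous fun θ : UnitAddTorus (Fin n) => fderiv ℝ u (rot θ z) :=
      (hu.continuous_fderiv (by simp)).comp (continuous_rot.comp (Continuous.prodMk_right z))
    have h2 : Continuous fun θ : UnitAddTorus (Fin n) =>
        ((rot θ : Cn n →L[ℂ] Cn n).restrictScalars ℝ) :=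
      (ContinuousLinearMap.restrictScalarsL ℂ (Cn n) (Cn n) ℝ ℝ).continuous.comp
        continuous_rot_coe
    exact d.continuous.smul (h1.clm_comp h2)
  have hLi := hL.integrable_of_hasCompactSupport (μ := volume) (HasCompactSupport.of_compactSpace _)
  have hLe : ∀ e : Cn n, Integrable fun θ => d θ * fderiv ℝ u (rot θ z) (rot θ e) := fun e =>
    hLi.apply_continuousLinearMap e
  simp only [creation, wirtinger, (hasFDerivAt_torusAvg_real d hu z).fderiv]
  rw [ContinuousLinearMap.integral_apply hLi, ContinuousLinearMap.integral_apply hLi]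
  have e1 : torusAvg (d * coordChar j) (creation j u) z =
      ∫ θ, (-((d θ * fderiv ℝ u (rot θ z) (rot θ (EuclideanSpace.single j 1))) -
        Complex.I * (d θ * fderiv ℝ u (rot θ z) (rot θ (EuclideanSpace.single j Complex.I)))) +
        (starRingEnd ℂ) (z j) / 2 * (d θ * u (rot θ z))) := by
    refine integral_congr_ae (Eventually.of_forall fun θ => ?_)
    have h := creation_comp_rot j θ hu z
    have h1 : HasFDerivAt u (fderiv ℝ u (rot θ z)) (rot θ z) :=
      ((hu.differentiable (by simp)) _).hasFDerivAt
    have h2 := (h1.comp z ((rot θ : Cn n →L[ℂ] Cn n).restrictScalars ℝ).hasFDerivAt).fderiv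
    have h5 : fderiv ℝ (u ∘ rot θ) z = fderiv ℝ u (rot θ z) ∘L
      (rot θ : Cn n →L[ℂ] Cn n).restrictScalars ℝ := h2
    have h6 : ∀ e : Cn n, fderiv ℝ (u ∘ rot θ) z e = fderiv ℝ u (rot θ z) (rot θ e) := by
      intro e
      rw [h5]
      rfl
    simp only [ContinuousMap.mul_apply, mul_assoc]
    rw [← h, creation, wirtinger, h6, h6, Function.comp_apply]
    ring
  rw [e1, integral_add, integral_neg, integral_sub (hLe _), integral_const_mul, integral_const_mul]
  · simp only [torusAvg]
    simp only [smul_apply, ContinuousLinearMap.comp_apply, smul_eq_mul]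
    simp only [ContinuousLinearMap.coe_restrictScalars',
      ContinuousLinearEquiv.coe_coe, LinearIsometryEquiv.coe_toContinuousLinearEquiv]
    ring
  · exact (hLe _).const_mul _
  · exact ((hLe _).sub ((hLe _).const_mul _)).neg
  · exact (hint u hu.continuous).const_mul _

/-! ### Entire functions equivariant under the torus -/

/-- An entire function which is homogeneous of degree `m` on the unit circle is a monomial. -/
theorem eq_pow_mul_of_circle {φ : ℂ → ℂ} (hφ : Differentiable ℂ φ) (m : ℕ)
    (h : ∀ c : ℂ, ‖c‖ = 1 → φ c = c ^ m * φ 1) (s : ℂ) : φ s = s ^ m * φ 1 := by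
  have h1 : AnalyticOnNhd ℂ φ Set.univ := fun z _ => hφ.analyticAt z
  have h2 : AnalyticOnNhd ℂ (fun s => s ^ m * φ 1) Set.univ := fun z _ =>
    ((differentiable_id.pow m).mul_const (φ 1)).analyticAt z
  have h3 : HasDerivAt (fun t : ℝ => Complex.exp (t * Complex.I))
      (Complex.exp ((0 : ℝ) * Complex.I) * (1 * Complex.I)) 0 :=
    ((Complex.ofRealCLM.hasDerivAt (x := (0 : ℝ))).mul_const Complex.I).cexp
  -- The curve t ↦ e^{it} has nonzero derivative at 0, so it approaches 1 through points other than
  -- 1; the identity theorem applies there.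
  have h4 := h3.tendsto_nhdsNE (by simp)
  have h5 : ∃ᶠ z in 𝓝[≠] (Complex.exp ((0 : ℝ) * Complex.I)), φ z = z ^ m * φ 1 := by
    refine h4.frequently (Eventually.frequently (Eventually.of_forall fun t => ?_))
    exact h _ (Complex.norm_exp_ofReal_mul_I t)
  exact congrFun (h1.eq_of_frequently_eq h2 h5) s

/-- The monomial `z^k`. -/
def monomialFun {n : ℕ} (k : Fin n → ℕ) (z : Cn n) : ℂ := ∏ j, z j ^ k j

/-- The character `θ ↦ e^{i k θ}` of the torus. -/
def torusChar {n : ℕ} (k : Fin n → ℕ) : C(UnitAddTorus (Fin n), ℂ) := ∏ j, coordChar j ^ k j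

theorem torusChar_apply {n : ℕ} (k : Fin n → ℕ) (θ : UnitAddTorus (Fin n)) :
    torusChar k θ = ∏ j, coordChar j θ ^ k j := by
  simp [torusChar, ContinuousMap.prod_apply]

theorem coordChar_add {n : ℕ} (j : Fin n) (θ τ : UnitAddTorus (Fin n)) :
    coordChar j (θ + τ) = coordChar j θ * coordChar j τ := by
  simp [coordChar, AddCircle.toCircle_add]

theorem norm_coordChar {n : ℕ} (j : Fin n) (θ : UnitAddTorus (Fin n)) :
    ‖coordChar j θ‖ = 1 :=
  Circle.norm_coe _

theorem torusChar_add {n : ℕ} (k : Fin n → ℕ) (θ τ : UnitAddTorus (Fin n)) :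
    torusChar k (θ + τ) = torusChar k θ * torusChar k τ := by
  simp [torusChar_apply, coordChar_add, mul_pow, Finset.prod_mul_distrib]

theorem norm_torusChar {n : ℕ} (k : Fin n → ℕ) (θ : UnitAddTorus (Fin n)) :
    ‖torusChar k θ‖ = 1 := by
  simp [torusChar_apply, norm_prod, norm_coordChar]

theorem star_torusChar_mul_self {n : ℕ} (k : Fin n → ℕ) :
    star (torusChar k) * torusChar k = 1 := by
  ext θ
  simp only [ContinuousMap.mul_apply, ContinuousMap.star_apply, ContinuousMap.one_apply]
  rw [Complex.star_def, Complex.conj_mul', norm_torusChar]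
  simp

theorem monomialFun_rot {n : ℕ} (k : Fin n → ℕ) (θ : UnitAddTorus (Fin n)) (z : Cn n) :
    monomialFun k (rot θ z) = torusChar k θ * monomialFun k z := by
  rw [monomialFun, monomialFun, torusChar_apply, ← Finset.prod_mul_distrib]
  exact Finset.prod_congr rfl fun j _ => by rw [rot_apply, mul_pow]; rfl

/-- Rotating one coordinate alone reduces to the one-variable case, which pulls out a factor
z_j^{k_j} and sets that coordinate to 1. Peeling off all coordinates leaves the value at (1, …, 1).
-/
theorem eq_monomialFun_of_equivariant {n : ℕ} (k : Fin n → ℕ) {H : Cn n → ℂ}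
    (hH : Differentiable ℂ H)
    (heq : ∀ θ z, H (rot θ z) = torusChar k θ * H z) (z : Cn n) :
    H z = H (WithLp.toLp 2 1) * monomialFun k z := by
  classical
  have step : ∀ (w : Fin n → ℂ) (j : Fin n) (s : ℂ), H (WithLp.toLp 2 (Function.update w j s)) =
      s ^ k j * H (WithLp.toLp 2 (Function.update w j 1)) := by
    intro w j
    refine eq_pow_mul_of_circle (φ := fun s => H (WithLp.toLp 2 (Function.update w j s))) ?_ _ ?_
    · have h1 : Differentiable ℂ fun s : ℂ => Function.update w j s := by
        rw [differentiable_pi]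
        intro i
        by_cases h : i = j
        · subst h
          simp
        · simp [h]
      exact hH.comp ((PiLp.continuousLinearEquiv 2 ℂ fun _ : Fin n => ℂ).symm.differentiable.comp h1)
    · intro c hc
      obtain ⟨t, ht⟩ := (AddCircle.homeomorphCircle (T := (1 : ℝ)) one_ne_zero).surjective
        ⟨c, mem_sphere_zero_iff_norm.2 hc⟩
      rw [AddCircle.homeomorphCircle_apply] at ht
      have e := heq (Pi.single j t) (WithLp.toLp 2 (Function.update w j 1))
      have e1 : rot (Pi.single j t) (WithLp.toLp 2 (Function.update w j 1)) =
          WithLp.toLp 2 (Function.update w j c) := by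
        ext i
        rw [rot_apply]
        by_cases h : i = j
        · subst h
          simp [ht]
        · simp [h]
      have e2 : torusChar k (Pi.single j t) = c ^ k j := by
        rw [torusChar_apply, Finset.prod_eq_single j]
        · simp [coordChar, ht]
        · intro i _ h
          simp [coordChar, h]
        · simp
      rw [← e1, e, e2]
  -- S is the set of coordinates already replaced by 1.
  have key : ∀ (S : Finset (Fin n)) (w : Fin n → ℂ), H (WithLp.toLp 2 w) =
      (∏ j ∈ S, w j ^ k j) * H (WithLp.toLp 2 (S.piecewise 1 w)) := by
    intro S w
    induction S using Finset.induction_on with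
    | empty => simp
    | insert j S hj ih =>
      rw [ih, Finset.prod_insert hj, Finset.piecewise_insert]
      have := step (S.piecewise 1 w) j (w j)
      have e : Function.update (S.piecewise 1 w) j (w j) = S.piecewise 1 w := by
        rw [Function.update_eq_self_iff, Finset.piecewise_eq_of_notMem _ _ _ hj]
      rw [e] at this
      rw [this, Pi.one_apply]
      ring
  have := key Finset.univ z.ofLp
  rw [Finset.piecewise_univ] at this
  rw [mul_comm]
  exact this

/-! ### Torus averages inside a Landau level -/

theorem torusAvg_star_torusChar_rot {n : ℕ} (k : Fin n → ℕ) (h : Cn n → ℂ)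
    (τ : UnitAddTorus (Fin n)) (z : Cn n) :
    torusAvg (star (torusChar k)) h (rot τ z) =
      torusChar k τ * torusAvg (star (torusChar k)) h z := by
  rw [torusAvg, torusAvg, ← integral_const_mul,
    ← integral_add_right_eq_self (fun θ => torusChar k τ * (star (torusChar k) θ * h (rot θ z))) τ]
  refine integral_congr_ae (Eventually.of_forall fun θ => ?_)
  simp only [ContinuousMap.star_apply, torusChar_add, star_mul', rot_add]
  have h1 : torusChar k τ * star (torusChar k τ) = 1 := by
    rw [Complex.star_def, Complex.mul_conj', norm_torusChar]
    simp
  linear_combination (-(star (torusChar k θ) * h (rot θ (rot τ z)))) * h1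

theorem torusAvg_gaussianMul {n : ℕ} (d : C(UnitAddTorus (Fin n), ℂ)) (h : Cn n → ℂ) :
    torusAvg d (gaussianMul h) = gaussianMul (torusAvg d h) := by
  funext z
  simp only [torusAvg, gaussianMul]
  rw [← integral_const_mul]
  refine integral_congr_ae (Eventually.of_forall fun θ => ?_)
  simp only [LinearIsometryEquiv.norm_map]
  ring

/-- Each application of q_j^* multiplies the weight by the j-th coordinate character. The weight
`star (torusChar k)` is therefore turned into the plain average. -/
theorem creationPow_torusAvg {n : ℕ} (k : Fin n → ℕ) (d : C(UnitAddTorus (Fin n), ℂ))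
    {u : Cn n → ℂ} (hu : ContDiff ℝ ∞ u) :
    creationPow k (torusAvg d u) = torusAvg (d * torusChar k) (creationPow k u) := by
  have iter : ∀ (j : Fin n) (m : ℕ) (d : C(UnitAddTorus (Fin n), ℂ)) (v : Cn n → ℂ),
      ContDiff ℝ ∞ v → (creation j)^[m] (torusAvg d v) =
        torusAvg (d * coordChar j ^ m) ((creation j)^[m] v) := by
    intro j m d v hv
    induction m with
    | zero => simp
    | succ m ih =>
      rw [Function.iterate_succ_apply', Function.iterate_succ_apply', ih,
        creation_torusAvg j _ (contDiff_creation_iterate j m hv), pow_succ, mul_assoc]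
  have fold : ∀ l : List (Fin n),
      l.foldr (fun j v => (creation j)^[k j] v) (torusAvg d u) =
        torusAvg (d * (l.map fun j => coordChar j ^ k j).prod)
          (l.foldr (fun j v => (creation j)^[k j] v) u) := by
    intro l
    induction l with
    | nil => simp
    | cons j l ih =>
      rw [List.foldr_cons, List.foldr_cons, ih, iter j (k j) _ _ (contDiff_foldr k l hu),
        List.map_cons, List.prod_cons, mul_assoc, mul_comm (coordChar j ^ k j)]
  rw [creationPow, creationPow, fold, torusChar, Fin.prod_univ_def]

theorem creationPow_comp_rot {n : ℕ} (k : Fin n → ℕ) (θ : UnitAddTorus (Fin n))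
    {u : Cn n → ℂ} (hu : ContDiff ℝ ∞ u) :
    creationPow k (u ∘ rot θ) = torusChar k θ • (creationPow k u ∘ rot θ) := by
  have hrot : ∀ v : Cn n → ℂ, ContDiff ℝ ∞ v → ContDiff ℝ ∞ (v ∘ rot θ) := fun v hv =>
    hv.comp ((rot θ : Cn n →L[ℂ] Cn n).restrictScalars ℝ).contDiff
  have one : ∀ (j : Fin n) (v : Cn n → ℂ), ContDiff ℝ ∞ v →
      creation j (v ∘ rot θ) = coordChar j θ • (creation j v ∘ rot θ) := fun j v hv =>
    funext fun z => creation_comp_rot j θ hv z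
  have iter : ∀ (j : Fin n) (m : ℕ) (v : Cn n → ℂ), ContDiff ℝ ∞ v →
      (creation j)^[m] (v ∘ rot θ) = (coordChar j θ ^ m) • ((creation j)^[m] v ∘ rot θ) := by
    intro j m v hv
    induction m with
    | zero => simp
    | succ m ih =>
      rw [Function.iterate_succ_apply', Function.iterate_succ_apply', ih,
        creation_smul j _ (hrot _ (contDiff_creation_iterate j m hv)),
        one j _ (contDiff_creation_iterate j m hv), smul_smul, pow_succ]
  have fold : ∀ l : List (Fin n),
      l.foldr (fun j v => (creation j)^[k j] v) (u ∘ rot θ) =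
        (l.map fun j => coordChar j θ ^ k j).prod •
          (l.foldr (fun j v => (creation j)^[k j] v) u ∘ rot θ) := by
    intro l
    induction l with
    | nil => simp
    | cons j l ih =>
      rw [List.foldr_cons, List.foldr_cons, ih,
        creation_iterate_smul j _ _ (hrot _ (contDiff_foldr k l hu)),
        iter j (k j) _ (contDiff_foldr k l hu), smul_smul,
        List.map_cons, List.prod_cons, mul_comm (coordChar j θ ^ k j)]
  rw [creationPow, creationPow, fold, torusChar_apply, Fin.prod_univ_def]

theorem contDiff_gaussianMul {n : ℕ} {p : Cn n → ℂ} (hp : ContDiff ℝ ∞ p) :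
    ContDiff ℝ ∞ (gaussianMul p) :=
  (Complex.ofRealCLM.contDiff.comp
      (Real.contDiff_exp.comp ((contDiff_norm_sq ℝ).div_const 4).neg)).mul hp

theorem contDiff_monomialFun {n : ℕ} (k : Fin n → ℕ) : ContDiff ℂ ∞ (monomialFun k) := by
  unfold monomialFun
  fun_prop

/-- The torus-invariant element of the `k`-th level. -/
def levelVacuum {n : ℕ} (k : Fin n → ℕ) : Cn n → ℂ :=
  creationPow k (gaussianMul (monomialFun k))

theorem contDiff_creationPow {n : ℕ} (k : Fin n → ℕ) {u : Cn n → ℂ} (hu : ContDiff ℝ ∞ u) :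
    ContDiff ℝ ∞ (creationPow k u) :=
  contDiff_foldr k _ hu

theorem contDiff_levelVacuum {n : ℕ} (k : Fin n → ℕ) : ContDiff ℝ ∞ (levelVacuum k) :=
  contDiff_creationPow k (contDiff_gaussianMul ((contDiff_monomialFun k).restrict_scalars ℝ))

/-- The monomial z^k and the operator q_k^* carry the same character, which cancels. -/
theorem levelVacuum_rot {n : ℕ} (k : Fin n → ℕ) (θ : UnitAddTorus (Fin n)) (z : Cn n) :
    levelVacuum k (rot θ z) = levelVacuum k z := by
  have hs := contDiff_gaussianMul ((contDiff_monomialFun k).restrict_scalars ℝ)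
  have h1 := creationPow_comp_rot k θ hs
  have h2 : gaussianMul (monomialFun k) ∘ rot θ =
      torusChar k θ • gaussianMul (monomialFun k) := by
    funext z
    simp only [gaussianMul, Function.comp_apply, LinearIsometryEquiv.norm_map, monomialFun_rot,
      Pi.smul_apply, smul_eq_mul]
    ring
  rw [h2, creationPow_smul k _ hs] at h1
  have h3 := congrFun h1 z
  have h4 : torusChar k θ ≠ 0 := norm_ne_zero_iff.1 (by rw [norm_torusChar]; exact one_ne_zero)
  exact (mul_left_cancel₀ h4 h3).symm

/-- The plain average is q_k^* applied to e^{-φ} times the part of h of weight k. That part is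
entire and equivariant, hence a multiple of z^k. -/
theorem exists_torusAvg_eq {n : ℕ} (k : Fin n → ℕ) {h : Cn n → ℂ} (hh : ContDiff ℂ ∞ h) :
    ∃ c : ℂ, torusAvg 1 (creationPow k (gaussianMul h)) = c • levelVacuum k := by
  have h1 := creationPow_torusAvg k (star (torusChar k))
    (contDiff_gaussianMul (hh.restrict_scalars ℝ))
  rw [star_torusChar_mul_self, torusAvg_gaussianMul] at h1
  refine ⟨torusAvg (star (torusChar k)) h (WithLp.toLp 2 1), ?_⟩
  have h2 : torusAvg (star (torusChar k)) h =
      torusAvg (star (torusChar k)) h (WithLp.toLp 2 1) • monomialFun k := funext fun z =>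
    eq_monomialFun_of_equivariant k (differentiable_torusAvg _ hh)
      (torusAvg_star_torusChar_rot k h) z
  rw [← h1, h2, gaussianMul_smul, levelVacuum, creationPow_smul k _
    (contDiff_gaussianMul ((contDiff_monomialFun k).restrict_scalars ℝ))]
  simp [monomialFun]

/-- Pairing with a torus-invariant function only sees the torus average. -/
theorem integral_mul_torusAvg {n : ℕ} {g f : Cn n → ℂ} (hg : Continuous g) (hf : Continuous f)
    (hinv : ∀ θ z, g (rot θ z) = g z) (hint : Integrable fun z => g z * f z) :
    ∫ z, g z * f z = ∫ z, g z * torusAvg 1 f z := by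
  have hi : ∀ θ : UnitAddTorus (Fin n), (fun z => g z * f (rot θ z)) =
      (fun z => g z * f z) ∘ rot θ := fun θ => funext fun z => by
    simp only [Function.comp_apply, hinv]
  have hemb : ∀ θ : UnitAddTorus (Fin n), MeasurableEmbedding (rot θ : Cn n → Cn n) := fun θ =>
    (rot θ).toHomeomorph.measurableEmbedding
  have hcont : Continuous fun p : Cn n × UnitAddTorus (Fin n) => g p.1 * f (rot p.2 p.1) :=
    (hg.comp continuous_fst).mul (hf.comp continuous_rot)
  -- Fubini applies because the L¹ norm of each slice in z does not depend on θ.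
  have hprod : Integrable (fun p : Cn n × UnitAddTorus (Fin n) => g p.1 * f (rot p.2 p.1))
      (volume.prod volume) := by
    rw [integrable_prod_iff' hcont.aestronglyMeasurable]
    constructor
    · refine Eventually.of_forall fun θ => ?_
      change Integrable (fun z => g z * f (rot θ z)) volume
      rw [hi θ]
      exact (measurePreserving_rot θ).integrable_comp_of_integrable hint
    · have : ∀ θ : UnitAddTorus (Fin n), ∫ z, ‖g z * f (rot θ z)‖ = ∫ z, ‖g z * f z‖ := by
        intro θ
        have := (measurePreserving_rot θ).integral_comp (hemb θ) (fun z => ‖g z * f z‖)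
        simpa only [hinv] using this
      simp only [this]
      exact integrable_const _
  have e1 : ∀ z, g z * torusAvg 1 f z = ∫ θ : UnitAddTorus (Fin n), g z * f (rot θ z) := by
    intro z
    rw [torusAvg, ← integral_const_mul]
    simp
  simp only [e1]
  rw [integral_integral_swap hprod]
  have e2 : ∀ θ : UnitAddTorus (Fin n), ∫ z, g z * f (rot θ z) = ∫ z, g z * f z := by
    intro θ
    have := (measurePreserving_rot θ).integral_comp (hemb θ) (fun z => g z * f z)
    simpa only [hinv] using this
  simp only [e2]
  simp

/-! ### Wirtinger calculus -/

theorem wirtinger_mul {n : ℕ} (j : Fin n) {u v : Cn n → ℂ} (hu : ContDiff ℝ ∞ u)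
    (hv : ContDiff ℝ ∞ v) (z : Cn n) :
    wirtinger j (fun z => u z * v z) z = u z * wirtinger j v z + wirtinger j u z * v z := by
  have h1 : DifferentiableAt ℝ u z := (hu.differentiable (by simp)) z
  have h2 : DifferentiableAt ℝ v z := (hv.differentiable (by simp)) z
  simp only [wirtinger, fderiv_fun_mul h1 h2, add_apply, smul_apply, smul_eq_mul]
  ring

theorem wirtinger_cexp {n : ℕ} (j : Fin n) {F : Cn n → ℂ} (hF : ContDiff ℝ ∞ F) (z : Cn n) :
    wirtinger j (fun z => Complex.exp (F z)) z = Complex.exp (F z) * wirtinger j F z := by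
  have h1 : DifferentiableAt ℝ F z := (hF.differentiable (by simp)) z
  simp only [wirtinger, h1.hasFDerivAt.cexp.fderiv, smul_apply, smul_eq_mul]
  ring

theorem wirtinger_gaussian {n : ℕ} (j : Fin n) (z : Cn n) :
    wirtinger j (fun z : Cn n => (Real.exp (-(‖z‖ ^ 2 / 4)) : ℂ)) z =
      (Real.exp (-(‖z‖ ^ 2 / 4)) : ℂ) * (-(starRingEnd ℂ) (z j) / 4) := by
  have hs : ContDiff ℝ ∞ fun z : Cn n => ((-(‖z‖ ^ 2 / 4) : ℝ) : ℂ) :=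
    Complex.ofRealCLM.contDiff.comp ((contDiff_norm_sq ℝ).div_const 4).neg
  simp only [Complex.ofReal_exp]
  rw [wirtinger_cexp j hs]
  congr 1
  have h1 : HasFDerivAt (fun z : Cn n => ‖z‖ ^ 2) (2 • innerSL ℝ z) z := by
    rw [← fderiv_norm_sq_apply]
    exact ((contDiff_norm_sq ℝ (n := 1)).differentiable (by simp) z).hasFDerivAt
  have h2 : HasFDerivAt (fun z : Cn n => ((-(‖z‖ ^ 2 / 4) : ℝ) : ℂ))
      (Complex.ofRealCLM ∘L ((-(1 / 4 : ℝ)) • (2 • innerSL ℝ z))) z := by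
    refine Complex.ofRealCLM.hasFDerivAt.comp z ?_
    refine (h1.const_mul (-(1 / 4 : ℝ))).congr_of_eventuallyEq (Eventually.of_forall fun w => ?_)
    change -(‖w‖ ^ 2 / 4) = -(1 / 4) * ‖w‖ ^ 2
    ring
  have h3 : ∀ c : ℂ, inner ℝ z (EuclideanSpace.single j c : Cn n) =
      ((starRingEnd ℂ) (z j) * c).re := by
    intro c
    rw [PiLp.inner_apply, Finset.sum_eq_single j]
    · simp [Complex.inner, mul_comm]
    · intro i _ h
      simp [h]
    · simp
  simp only [wirtinger, h2.fderiv, ContinuousLinearMap.comp_apply, smul_apply, innerSL_apply_apply,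
    h3]
  apply Complex.ext <;> simp <;> ring

/-- Differentiating e^{-φ} contributes conj z_j / 2, which doubles the zeroth-order term of q_j^*.
-/
theorem creation_gaussianMul {n : ℕ} (j : Fin n) {p : Cn n → ℂ} (hp : ContDiff ℝ ∞ p) :
    creation j (gaussianMul p) =
      gaussianMul fun z => -2 * wirtinger j p z + (starRingEnd ℂ) (z j) * p z := by
  have hs : ContDiff ℝ ∞ (fun z : Cn n => (Real.exp (-(‖z‖ ^ 2 / 4)) : ℂ)) :=
    Complex.ofRealCLM.contDiff.comp
      (Real.contDiff_exp.comp ((contDiff_norm_sq ℝ).div_const 4).neg)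
  funext z
  have h := wirtinger_mul j hs hp z
  rw [wirtinger_gaussian] at h
  have h' : wirtinger j (gaussianMul p) z = _ := h
  rw [creation, h', gaussianMul, gaussianMul]
  ring

/-! ### Temperate growth against Gaussian decay -/

theorem _root_.Function.HasTemperateGrowth.fderiv {E F : Type*} [NormedAddCommGroup E]
    [NormedSpace ℝ E] [NormedAddCommGroup F] [NormedSpace ℝ F] {f : E → F}
    (hf : f.HasTemperateGrowth) : (fderiv ℝ f).HasTemperateGrowth := by
  refine ⟨hf.1.fderiv_right (by simp), fun m => ?_⟩
  obtain ⟨k, C, h⟩ := hf.2 (m + 1)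
  exact ⟨k, C, fun x => by rw [norm_iteratedFDeriv_fderiv]; exact h x⟩

theorem hasTemperateGrowth_coord {n : ℕ} (j : Fin n) :
    Function.HasTemperateGrowth fun z : Cn n => z j :=
  ((EuclideanSpace.proj j : Cn n →L[ℂ] ℂ).restrictScalars ℝ).hasTemperateGrowth

theorem hasTemperateGrowth_wirtinger {n : ℕ} (j : Fin n) {p : Cn n → ℂ}
    (hp : p.HasTemperateGrowth) : (wirtinger j p).HasTemperateGrowth := by
  have h : ∀ e : Cn n, Function.HasTemperateGrowth fun z => fderiv ℝ p z e := fun e =>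
    (ContinuousLinearMap.apply ℝ ℂ e).hasTemperateGrowth.comp hp.fderiv
  have h2 : wirtinger j p = fun z => (1 / 2 : ℂ) * (fderiv ℝ p z (EuclideanSpace.single j 1) -
      Complex.I * fderiv ℝ p z (EuclideanSpace.single j Complex.I)) := by
    funext z
    rw [wirtinger]
    ring
  rw [h2]
  exact (Function.HasTemperateGrowth.const _).mul
    ((h _).sub ((Function.HasTemperateGrowth.const _).mul (h _)))

theorem exists_creationPow_gaussianMul {n : ℕ} (k : Fin n → ℕ) {p : Cn n → ℂ}
    (hp : p.HasTemperateGrowth) :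
    ∃ q : Cn n → ℂ, q.HasTemperateGrowth ∧ creationPow k (gaussianMul p) = gaussianMul q := by
  have one : ∀ (j : Fin n) (p : Cn n → ℂ), p.HasTemperateGrowth →
      ∃ q : Cn n → ℂ, q.HasTemperateGrowth ∧ creation j (gaussianMul p) = gaussianMul q :=
    fun j p hp => ⟨_, ((Function.HasTemperateGrowth.const (-2)).mul
      (hasTemperateGrowth_wirtinger j hp)).add
      (((Complex.conjCLE : ℂ →L[ℝ] ℂ).hasTemperateGrowth.comp (hasTemperateGrowth_coord j)).mul hp),
      creation_gaussianMul j hp.1⟩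
  have iter : ∀ (j : Fin n) (m : ℕ) (p : Cn n → ℂ), p.HasTemperateGrowth →
      ∃ q : Cn n → ℂ, q.HasTemperateGrowth ∧ (creation j)^[m] (gaussianMul p) = gaussianMul q := by
    intro j m p hp
    induction m with
    | zero => exact ⟨p, hp, rfl⟩
    | succ m ih =>
      obtain ⟨q, hq, e⟩ := ih
      rw [Function.iterate_succ_apply', e]
      exact one j q hq
  unfold creationPow
  induction List.finRange n with
  | nil => exact ⟨p, hp, rfl⟩
  | cons j l ih =>
    obtain ⟨q, hq, e⟩ := ih
    rw [List.foldr_cons, e]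
    exact iter j (k j) q hq

theorem hasTemperateGrowth_monomialFun {n : ℕ} (k : Fin n → ℕ) :
    (monomialFun k).HasTemperateGrowth := by
  unfold monomialFun
  induction (Finset.univ : Finset (Fin n)) using Finset.induction_on with
  | empty => simp
  | insert j S hj ih =>
    simp only [Finset.prod_insert hj]
    exact ((hasTemperateGrowth_coord j).pow (k j)).mul ih

theorem exists_norm_gaussianMul_le {n : ℕ} {p : Cn n → ℂ} (hp : p.HasTemperateGrowth) (M : ℕ) :
    ∃ C : ℝ, 0 ≤ C ∧ ∀ z, ‖gaussianMul p z‖ ≤ C * (1 + ‖z‖) ^ (-(M : ℝ)) := by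
  obtain ⟨N, C, h⟩ := hp.2 0
  have hC : 0 ≤ C := by simpa using (norm_nonneg _).trans (h 0)
  refine ⟨C * ((N + M).factorial * Real.exp 2), by positivity, fun z => ?_⟩
  have h1 := h z
  rw [norm_iteratedFDeriv_zero] at h1
  have h2 : 0 < 1 + ‖z‖ := by positivity
  -- Powers are absorbed by x^m / m! ≤ e^x, and 1 + r ≤ 2 + r²/4 since (r − 2)² ≥ 0; this is the
  -- source of the constant (N + M)! e².
  have h3 := Real.pow_div_factorial_le_exp (1 + ‖z‖) h2.le (N + M)
  rw [div_le_iff₀ (by positivity)] at h3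
  have h4 : Real.exp (1 + ‖z‖) ≤ Real.exp 2 * Real.exp (‖z‖ ^ 2 / 4) := by
    rw [← Real.exp_add, Real.exp_le_exp]
    nlinarith [sq_nonneg (‖z‖ - 2)]
  rw [Real.rpow_neg h2.le, Real.rpow_natCast, ← div_eq_mul_inv, le_div_iff₀ (by positivity),
    gaussianMul, norm_mul, Complex.norm_real, Real.norm_of_nonneg (Real.exp_pos _).le]
  calc Real.exp (-(‖z‖ ^ 2 / 4)) * ‖p z‖ * (1 + ‖z‖) ^ M
      ≤ Real.exp (-(‖z‖ ^ 2 / 4)) * (C * (1 + ‖z‖) ^ N) * (1 + ‖z‖) ^ M := by gcongr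
    _ = C * (Real.exp (-(‖z‖ ^ 2 / 4)) * (1 + ‖z‖) ^ (N + M)) := by rw [pow_add]; ring
    _ ≤ C * (Real.exp (-(‖z‖ ^ 2 / 4)) *
          ((Real.exp 2 * Real.exp (‖z‖ ^ 2 / 4)) * (N + M).factorial)) := by
        gcongr
        exact h3.trans (by gcongr)
    _ = C * ((N + M).factorial * Real.exp 2) *
          (Real.exp (-(‖z‖ ^ 2 / 4)) * Real.exp (‖z‖ ^ 2 / 4)) := by ring
    _ = _ := by rw [← Real.exp_add]; simp

theorem integrable_gaussianMul {n : ℕ} {p : Cn n → ℂ} (hp : p.HasTemperateGrowth) :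
    Integrable (gaussianMul p) := by
  -- An exponent above the real dimension makes (1 + |z|)^{-M} integrable.
  obtain ⟨C, -, h⟩ := exists_norm_gaussianMul_le hp (Module.finrank ℝ (Cn n) + 1)
  refine Integrable.mono' ((integrable_one_add_norm (by simp)).const_mul C)
    (contDiff_gaussianMul hp.1).continuous.aestronglyMeasurable (Eventually.of_forall h)

theorem memLp_gaussianMul {n : ℕ} {p : Cn n → ℂ} (hp : p.HasTemperateGrowth) :
    MemLp (gaussianMul p) 2 := by
  have hm := (contDiff_gaussianMul hp.1).continuous.aestronglyMeasurable (μ := volume)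
  rw [memLp_two_iff_integrable_sq_norm hm]
  obtain ⟨C, hC, h⟩ := exists_norm_gaussianMul_le hp 0
  refine Integrable.mono' ((integrable_gaussianMul hp).norm.const_mul C) (hm.norm.pow 2)
    (Eventually.of_forall fun z => ?_)
  have := h z
  simp only [CharP.cast_eq_zero, neg_zero, Real.rpow_zero, mul_one] at this
  rw [Real.norm_of_nonneg (by positivity), sq]
  gcongr

theorem integrable_levelVacuum {n : ℕ} (k : Fin n → ℕ) : Integrable (levelVacuum k) := by
  obtain ⟨q, hq, e⟩ := exists_creationPow_gaussianMul k (hasTemperateGrowth_monomialFun k)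
  rw [levelVacuum, e]
  exact integrable_gaussianMul hq

theorem memLp_levelVacuum {n : ℕ} (k : Fin n → ℕ) : MemLp (levelVacuum k) 2 := by
  obtain ⟨q, hq, e⟩ := exists_creationPow_gaussianMul k (hasTemperateGrowth_monomialFun k)
  rw [levelVacuum, e]
  exact memLp_gaussianMul hq

/-! ### The reproducing kernel -/

/-- The reproducing kernel of the `k`-th level at the origin. -/
def originKernel {n : ℕ} (k : Fin n → ℕ) : Cn n → ℂ :=
  (starRingEnd ℂ) (levelVacuum k 0 /
    ∫ z, (starRingEnd ℂ) (levelVacuum k z) * levelVacuum k z) • levelVacuum k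

/-- The origin is fixed by the torus, so f(0) = c · v(0), where v is the invariant vector and c v
the average of f. Pairing f with v gives c ‖v‖², and the normalisation of the kernel divides this
out. -/
theorem apply_zero_eq_integral {n : ℕ} (k : Fin n → ℕ) {h : Cn n → ℂ} (hh : ContDiff ℂ ∞ h)
    (hf : MemLp (creationPow k (gaussianMul h)) 2) :
    creationPow k (gaussianMul h) 0 =
      ∫ z, (starRingEnd ℂ) (originKernel k z) * creationPow k (gaussianMul h) z := by
  have hgc : Continuous (levelVacuum k) := (contDiff_levelVacuum k).continuous
  have hfc : Continuous (creationPow k (gaussianMul h)) :=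
    (contDiff_creationPow k (contDiff_gaussianMul (hh.restrict_scalars ℝ))).continuous
  obtain ⟨c, hc⟩ := exists_torusAvg_eq k hh
  have h0 : creationPow k (gaussianMul h) 0 = c * levelVacuum k 0 := by
    have := congrFun hc 0
    simpa [torusAvg] using this
  have h1 := integral_mul_torusAvg (g := fun z => (starRingEnd ℂ) (levelVacuum k z))
    (Complex.continuous_conj.comp hgc) hfc (fun θ z => by simp only [levelVacuum_rot])
    ((memLp_levelVacuum k).star.integrable_mul hf)
  simp only [originKernel, Pi.smul_apply, smul_eq_mul, map_mul, Complex.conj_conj, mul_assoc]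
  rw [integral_const_mul, h1, hc, h0]
  simp only [Pi.smul_apply, smul_eq_mul]
  have h2 : ∀ z, (starRingEnd ℂ) (levelVacuum k z) * (c * levelVacuum k z) =
      c * ((starRingEnd ℂ) (levelVacuum k z) * levelVacuum k z) := fun z => by ring
  simp only [h2]
  rw [integral_const_mul]
  -- If the norm of v vanishes, then v = 0 by continuity and both sides are 0; no proof that v ≠ 0
  -- is required.
  by_cases hN : ∫ z, (starRingEnd ℂ) (levelVacuum k z) * levelVacuum k z = 0
  · have h3 : levelVacuum k 0 = 0 := by
      have h4 : ∫ z, ‖levelVacuum k z‖ ^ 2 = 0 := by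
        simp only [Complex.conj_mul'] at hN
        exact_mod_cast hN
      rw [integral_eq_zero_iff_of_nonneg (fun z => by positivity)
        ((memLp_two_iff_integrable_sq_norm (memLp_levelVacuum k).1).1 (memLp_levelVacuum k))] at h4
      have h5 := (hgc.norm.pow 2).ae_eq_iff_eq (μ := volume) continuous_zero |>.1 h4
      simpa using congrFun h5 0
    simp [h3]
  · field_simp

/-! ### Magnetic translations -/

/-- The real linear exponent `i Im⟪ζ, z⟫ / 2`. -/
def phaseExponent {n : ℕ} (ζ : Cn n) : Cn n →L[ℝ] ℂ :=
  (Complex.I / 2) • (Complex.ofRealCLM ∘L Complex.imCLM ∘L (innerSL ℂ ζ).restrictScalars ℝ)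

theorem phaseExponent_apply {n : ℕ} (ζ z : Cn n) :
    phaseExponent ζ z = Complex.I / 2 * ((inner ℂ ζ z).im : ℂ) := rfl

/-- The magnetic translation by `ζ`. -/
def magTranslate {n : ℕ} (ζ : Cn n) (u : Cn n → ℂ) (z : Cn n) : ℂ :=
  Complex.exp (phaseExponent ζ z) * u (z - ζ)

theorem norm_exp_phaseExponent {n : ℕ} (ζ z : Cn n) :
    ‖Complex.exp (phaseExponent ζ z)‖ = 1 := by
  have : phaseExponent ζ z = (((inner ℂ ζ z).im / 2 : ℝ) : ℂ) * Complex.I := by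
    rw [phaseExponent_apply]
    push_cast
    ring
  rw [this, Complex.norm_exp_ofReal_mul_I]

theorem norm_magTranslate {n : ℕ} (ζ : Cn n) (u : Cn n → ℂ) (z : Cn n) :
    ‖magTranslate ζ u z‖ = ‖u (z - ζ)‖ := by
  rw [magTranslate, norm_mul, norm_exp_phaseExponent, one_mul]

theorem contDiff_exp_phaseExponent {n : ℕ} (ζ : Cn n) :
    ContDiff ℝ ∞ fun z => Complex.exp (phaseExponent ζ z) :=
  (phaseExponent ζ).contDiff.cexp

theorem wirtinger_phaseExponent {n : ℕ} (j : Fin n) (ζ z : Cn n) :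
    wirtinger j (phaseExponent ζ) z = (starRingEnd ℂ) (ζ j) / 4 := by
  rw [wirtinger, (phaseExponent ζ).fderiv, phaseExponent_apply, phaseExponent_apply,
    EuclideanSpace.inner_single_right, EuclideanSpace.inner_single_right]
  apply Complex.ext <;> simp <;> ring

/-- Differentiating the phase contributes −conj ζ_j / 2, which turns the coefficient conj z_j / 2
into conj (z − ζ)_j / 2. -/
theorem creation_magTranslate {n : ℕ} (j : Fin n) (ζ : Cn n) {u : Cn n → ℂ}
    (hu : ContDiff ℝ ∞ u) :
    creation j (magTranslate ζ u) = magTranslate ζ (creation j u) := by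
  funext z
  have h1 := wirtinger_mul j (contDiff_exp_phaseExponent ζ)
    (hu.comp (contDiff_id.sub (contDiff_const (c := ζ)))) z
  have h2 : wirtinger j (u ∘ fun z => id z - ζ) z = wirtinger j u (z - ζ) := by
    have : fderiv ℝ (u ∘ fun z => id z - ζ) z = fderiv ℝ u (z - ζ) := fderiv_comp_sub ζ
    rw [wirtinger, wirtinger, this]
  rw [wirtinger_cexp j (phaseExponent ζ).contDiff, wirtinger_phaseExponent, h2] at h1
  have h3 : wirtinger j (magTranslate ζ u) z = _ := h1
  rw [creation, h3, magTranslate, magTranslate, creation]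
  simp only [Function.comp_apply, id_eq, PiLp.sub_apply, map_sub]
  ring

theorem creationPow_magTranslate {n : ℕ} (k : Fin n → ℕ) (ζ : Cn n) {u : Cn n → ℂ}
    (hu : ContDiff ℝ ∞ u) :
    creationPow k (magTranslate ζ u) = magTranslate ζ (creationPow k u) := by
  have iter : ∀ (j : Fin n) (m : ℕ) (v : Cn n → ℂ), ContDiff ℝ ∞ v →
      (creation j)^[m] (magTranslate ζ v) = magTranslate ζ ((creation j)^[m] v) := by
    intro j m v hv
    induction m with
    | zero => rfl
    | succ m ih =>
      rw [Function.iterate_succ_apply', Function.iterate_succ_apply', ih,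
        creation_magTranslate j ζ (contDiff_creation_iterate j m hv)]
  unfold creationPow
  induction List.finRange n with
  | nil => rfl
  | cons j l ih =>
    rw [List.foldr_cons, List.foldr_cons, ih, iter j (k j) _ (contDiff_foldr k l hu)]

theorem memLp_magTranslate {n : ℕ} (ζ : Cn n) {u : Cn n → ℂ} (hu : MemLp u 2) :
    MemLp (magTranslate ζ u) 2 := by
  have h1 : MemLp (fun z => u (z - ζ)) 2 :=
    hu.comp_measurePreserving (measurePreserving_sub_right volume ζ)
  refine h1.of_le ((contDiff_exp_phaseExponent ζ).continuous.aestronglyMeasurable.mul h1.1)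
    (Eventually.of_forall fun z => (norm_magTranslate ζ u z).le)

/-- Expanding |z − ζ|² produces Re⟪ζ, z⟫ / 2, which the phase completes to ⟪ζ, z⟫ / 2. This is
holomorphic in z, so the Fock space is preserved. -/
theorem magTranslate_gaussianMul {n : ℕ} (ζ : Cn n) (h : Cn n → ℂ) :
    magTranslate ζ (gaussianMul h) =
      gaussianMul fun z => Complex.exp (inner ℂ ζ z / 2 - (‖ζ‖ : ℂ) ^ 2 / 4) * h (z - ζ) := by
  funext z
  have h1 : ‖z - ζ‖ ^ 2 = ‖z‖ ^ 2 - 2 * (inner ℂ ζ z).re + ‖ζ‖ ^ 2 := by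
    rw [norm_sub_sq (𝕜 := ℂ), ← inner_re_symm]
    rfl
  simp only [magTranslate, gaussianMul, ← mul_assoc, Complex.ofReal_exp, ← Complex.exp_add]
  congr 2
  rw [phaseExponent_apply, h1]
  nth_rewrite 3 [← Complex.re_add_im (inner ℂ ζ z)]
  push_cast
  ring

theorem IsFock.exists_magTranslate {n : ℕ} {h : Cn n → ℂ} (hh : IsFock h) (ζ : Cn n) :
    ∃ h', IsFock h' ∧ magTranslate ζ (gaussianMul h) = gaussianMul h' := by
  refine ⟨_, ⟨?_, ?_⟩, magTranslate_gaussianMul ζ h⟩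
  · have h2 : ContDiff ℂ ω h := contDiffOn_univ.1 (hh.1.contDiffOn uniqueDiffOn_univ)
    have h3 : ContDiff ℂ ω fun z : Cn n => inner ℂ ζ z := (innerSL ℂ ζ).contDiff
    have h4 : ContDiff ℂ ω fun z =>
        Complex.exp (inner ℂ ζ z / 2 - (‖ζ‖ : ℂ) ^ 2 / 4) * h (z - ζ) :=
      ((h3.div_const 2).sub contDiff_const).cexp.mul (h2.comp (contDiff_id.sub contDiff_const))
    exact h4.analyticOnNhd
  · rw [← magTranslate_gaussianMul]
    exact memLp_magTranslate ζ hh.2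

/-- The reproducing kernel of the `k`-th level at `ζ`. -/
def levelKernel {n : ℕ} (k : Fin n → ℕ) (ζ : Cn n) : Cn n → ℂ := magTranslate ζ (originKernel k)

theorem IsFock.contDiff_complex {n : ℕ} {h : Cn n → ℂ} (hh : IsFock h) : ContDiff ℂ ∞ h :=
  contDiffOn_univ.1 (hh.1.contDiffOn uniqueDiffOn_univ)

theorem IsFock.apply_eq_integral {n : ℕ} (k : Fin n → ℕ) {h : Cn n → ℂ} (hh : IsFock h)
    (hf : MemLp (creationPow k (gaussianMul h)) 2) (ζ : Cn n) :
    creationPow k (gaussianMul h) ζ =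
      ∫ z, (starRingEnd ℂ) (levelKernel k ζ z) * creationPow k (gaussianMul h) z := by
  set f := creationPow k (gaussianMul h) with hfdef
  obtain ⟨h', hh', e⟩ := hh.exists_magTranslate (-ζ)
  have e1 : creationPow k (gaussianMul h') = magTranslate (-ζ) f := by
    rw [← e, creationPow_magTranslate k _ hh.contDiff]
  have e2 := apply_zero_eq_integral k hh'.contDiff_complex
    (by rw [e1]; exact memLp_magTranslate _ hf)
  rw [e1] at e2
  have e3 : magTranslate (-ζ) f 0 = f ζ := by simp [magTranslate]
  rw [← e3, e2, ← integral_sub_right_eq_self _ ζ]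
  refine integral_congr_ae (Eventually.of_forall fun z => ?_)
  -- The shift by ζ leaves the phase unchanged because Im⟪ζ, ζ⟫ = 0.
  have e4 : phaseExponent (-ζ) (z - ζ) = (starRingEnd ℂ) (phaseExponent ζ z) := by
    have : (inner ℂ ζ ζ).im = 0 := by
      rw [inner_self_eq_norm_sq_to_K]
      norm_cast
    simp only [phaseExponent_apply, inner_neg_left, inner_sub_right, Complex.neg_im,
      Complex.sub_im, this, map_mul, map_div₀, Complex.conj_I, Complex.conj_ofReal,
      Complex.conj_ofNat]
    push_cast
    ring
  simp only [levelKernel, magTranslate, map_mul, e4, sub_neg_eq_add, sub_add_cancel,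
    Complex.exp_conj]
  ring

theorem isFock_monomialFun {n : ℕ} (k : Fin n → ℕ) : IsFock (monomialFun k) := by
  refine ⟨?_, memLp_gaussianMul (hasTemperateGrowth_monomialFun k)⟩
  have h4 : ContDiff ℂ ω (monomialFun k) := by
    unfold monomialFun
    fun_prop
  exact h4.analyticOnNhd

theorem IsFock.const_smul {n : ℕ} {h : Cn n → ℂ} (hh : IsFock h) (c : ℂ) : IsFock (c • h) :=
  ⟨hh.1.const_smul, by rw [gaussianMul_smul]; exact hh.2.const_smul c⟩

theorem exists_levelKernel_eq {n : ℕ} (k : Fin n → ℕ) (ζ : Cn n) :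
    ∃ h, IsFock h ∧ levelKernel k ζ = creationPow k (gaussianMul h) := by
  obtain ⟨h, hh, e⟩ := ((isFock_monomialFun k).const_smul ((starRingEnd ℂ) (levelVacuum k 0 /
    ∫ z, (starRingEnd ℂ) (levelVacuum k z) * levelVacuum k z))).exists_magTranslate ζ
  refine ⟨h, hh, ?_⟩
  rw [← e, creationPow_magTranslate, gaussianMul_smul, creationPow_smul, levelKernel, originKernel,
    levelVacuum]
  · exact (isFock_monomialFun k).contDiff
  · exact ((isFock_monomialFun k).const_smul _).contDiff

theorem integrable_originKernel {n : ℕ} (k : Fin n → ℕ) : Integrable (originKernel k) :=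
  (integrable_levelVacuum k).smul _

theorem continuous_originKernel {n : ℕ} (k : Fin n → ℕ) : Continuous (originKernel k) :=
  (contDiff_levelVacuum k).continuous.const_smul _

theorem memLp_levelKernel {n : ℕ} (k : Fin n → ℕ) (ζ : Cn n) : MemLp (levelKernel k ζ) 2 :=
  memLp_magTranslate ζ ((memLp_levelVacuum k).const_smul _)

/-! ### The projection as an integral operator -/

/-- The reproducing kernel at `ζ` as a vector of `L²`. -/
def levelVec {n : ℕ} (k : Fin n → ℕ) (ζ : Cn n) : L2Cn n := (memLp_levelKernel k ζ).toLp _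

theorem levelVec_mem {n : ℕ} (k : Fin n → ℕ) (ζ : Cn n) : levelVec k ζ ∈ landauLevel n k := by
  refine Submodule.le_topologicalClosure _ ?_
  obtain ⟨h, hh, e⟩ := exists_levelKernel_eq k ζ
  refine ⟨h, hh, ?_⟩
  rw [← e]
  exact (memLp_levelKernel k ζ).coeFn_toLp

theorem inner_levelVec {n : ℕ} (k : Fin n → ℕ) (ζ : Cn n) (u : L2Cn n) :
    inner ℂ (levelVec k ζ) u = ∫ w, (starRingEnd ℂ) (levelKernel k ζ w) * u w := by
  rw [L2.inner_def]
  refine integral_congr_ae ?_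
  filter_upwards [(memLp_levelKernel k ζ).coeFn_toLp] with w hw
  rw [levelVec, hw, RCLike.inner_apply, mul_comm]

theorem inner_levelVec_of_ae_eq {n : ℕ} (k : Fin n → ℕ) {h : Cn n → ℂ} (hh : IsFock h)
    {u : L2Cn n} (hu : u =ᵐ[volume] creationPow k (gaussianMul h)) (ζ : Cn n) :
    inner ℂ (levelVec k ζ) u = creationPow k (gaussianMul h) ζ := by
  rw [inner_levelVec, hh.apply_eq_integral k ((memLp_congr_ae hu).1 (Lp.memLp u))]
  refine integral_congr_ae ?_
  filter_upwards [hu] with w hw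
  rw [hw]

/-- The reproducing formula passes from q_k^* L_0 to its closure: a subsequence converges almost
everywhere, and the right side is continuous in u. -/
theorem ae_eq_inner_levelVec {n : ℕ} {k : Fin n → ℕ} {u : L2Cn n} (hu : u ∈ landauLevel n k) :
    ∀ᵐ z, u z = inner ℂ (levelVec k z) u := by
  have hu' : u ∈ closure (landauSpace n k : Set (L2Cn n)) := by
    rwa [← Submodule.topologicalClosure_coe]
  obtain ⟨v, hv, hlim⟩ := mem_closure_iff_seq_limit.1 hu'
  obtain ⟨ns, hns, hae⟩ := (tendstoInMeasure_of_tendsto_Lp hlim).exists_seq_tendsto_ae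
  have h1 : ∀ i, ∀ᵐ z, v i z = inner ℂ (levelVec k z) (v i) := by
    intro i
    obtain ⟨h, hh, e⟩ := hv i
    filter_upwards [e] with z hz
    rw [hz, inner_levelVec_of_ae_eq k hh e]
  filter_upwards [hae, ae_all_iff.2 h1] with z hz h1z
  refine tendsto_nhds_unique hz ?_
  simp only [h1z]
  exact (tendsto_const_nhds.inner hlim).comp hns.tendsto_atTop

/-- The projection is self-adjoint and fixes the kernel vectors, which lie in the level. -/
theorem landauProj_ae_eq {n : ℕ} (k : Fin n → ℕ) (u : L2Cn n) :
    ∀ᵐ z, landauProj n k u z = inner ℂ (levelVec k z) u := by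
  filter_upwards [ae_eq_inner_levelVec
    ((landauLevel n k).starProjection_apply_mem u)] with z hz
  rw [landauProj, hz, ← Submodule.inner_starProjection_left_eq_right,
    Submodule.starProjection_eq_self_iff.2 (levelVec_mem k z)]

theorem continuous_levelKernel {n : ℕ} (k : Fin n → ℕ) :
    Continuous fun p : Cn n × Cn n => levelKernel k p.2 p.1 := by
  unfold levelKernel magTranslate
  simp only [phaseExponent_apply]
  have h := continuous_originKernel k
  fun_prop

/-- ‖v w − v z‖² is a combination of inner products, continuous in w and zero at w = z. -/
theorem continuous_of_continuous_gram {X H : Type*} [TopologicalSpace X] [NormedAddCommGroup H]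
    [InnerProductSpace ℂ H] {v : X → H}
    (h : Continuous fun p : X × X => inner ℂ (v p.1) (v p.2)) : Continuous v := by
  rw [continuous_iff_continuousAt]
  intro z
  rw [ContinuousAt, tendsto_iff_norm_sub_tendsto_zero]
  have h5 : Continuous fun w => inner ℂ (v w) (v w) := h.comp (continuous_id.prodMk continuous_id)
  have h6 : Continuous fun w => inner ℂ (v w) (v z) := h.comp (Continuous.prodMk_left z)
  have h3 : Continuous fun w => (inner ℂ (v w) (v w)).re - 2 * (inner ℂ (v w) (v z)).re +
      (inner ℂ (v z) (v z)).re := by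
    fun_prop
  have h7 := h3.tendsto z
  have h8 : (inner ℂ (v z) (v z)).re - 2 * (inner ℂ (v z) (v z)).re +
      (inner ℂ (v z) (v z)).re = 0 := by ring
  rw [h8] at h7
  have h2 : Tendsto (fun w => ‖v w - v z‖ ^ 2) (𝓝 z) (𝓝 0) := by
    refine h7.congr fun w => ?_
    rw [norm_sub_sq (𝕜 := ℂ), ← inner_self_eq_norm_sq (𝕜 := ℂ), ← inner_self_eq_norm_sq (𝕜 := ℂ)]
    rfl
  simpa using h2.sqrt

theorem inner_levelVec_levelVec {n : ℕ} (k : Fin n → ℕ) (z w : Cn n) :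
    inner ℂ (levelVec k z) (levelVec k w) = levelKernel k w z := by
  obtain ⟨h, hh, e⟩ := exists_levelKernel_eq k w
  have h1 : levelVec k w =ᵐ[volume] levelKernel k w := (memLp_levelKernel k w).coeFn_toLp
  rw [e] at h1 ⊢
  exact inner_levelVec_of_ae_eq k hh h1 z

theorem continuous_levelVec {n : ℕ} (k : Fin n → ℕ) : Continuous (levelVec k) := by
  have h3 : Continuous fun p : Cn n × Cn n => inner ℂ (levelVec k p.1) (levelVec k p.2) := by
    simpa only [inner_levelVec_levelVec] using continuous_levelKernel k
  exact continuous_of_continuous_gram h3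

/-! ### Operators with square integrable kernels -/

/-- The operator `u ↦ (z ↦ Φ z u)` for square integrable `Φ`. -/
def kernelOp {X E : Type*} [MeasurableSpace X] (μ : Measure X) [NormedAddCommGroup E]
    [NormedSpace ℂ E] : Lp (E →L[ℂ] ℂ) 2 μ →L[ℂ] E →L[ℂ] Lp ℂ 2 μ :=
  (ContinuousLinearMap.compLpL₂ 2 μ (ContinuousLinearMap.id ℂ (E →L[ℂ] ℂ)).flip).flip

theorem coeFn_kernelOp {X E : Type*} [MeasurableSpace X] (μ : Measure X) [NormedAddCommGroup E]
    [NormedSpace ℂ E] (Φ : Lp (E →L[ℂ] ℂ) 2 μ) (u : E) :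
    kernelOp μ Φ u =ᵐ[μ] fun z => Φ z u := by
  simp only [kernelOp, ContinuousLinearMap.flip_apply, ContinuousLinearMap.compLpL₂_apply_apply]
  exact ContinuousLinearMap.coeFn_compLp _ _

/-- An indicator times a functional gives an operator of rank at most one. Sums and L² limits
follow, as `kernelOp` is continuous and the compact operators are closed. -/
theorem isCompactOperator_kernelOp {X E : Type*} [MeasurableSpace X] (μ : Measure X)
    [NormedAddCommGroup E] [NormedSpace ℂ E] (Φ : Lp (E →L[ℂ] ℂ) 2 μ) :
    IsCompactOperator (kernelOp μ Φ) := by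
  refine Lp.induction (by simp) (motive := fun Φ => IsCompactOperator (kernelOp μ Φ)) ?_ ?_ ?_ Φ
  · intro c s hs hμs
    have e : kernelOp μ (Lp.simpleFunc.indicatorConst 2 hs hμs.ne c : Lp (E →L[ℂ] ℂ) 2 μ) =
        ContinuousLinearMap.toSpanSingleton ℂ (indicatorConstLp 2 hs hμs.ne (1 : ℂ)) ∘L c := by
      ext1 u
      refine Lp.ext ?_
      rw [Lp.simpleFunc.coe_indicatorConst]
      rw [ContinuousLinearMap.comp_apply, ContinuousLinearMap.toSpanSingleton_apply]
      filter_upwards [coeFn_kernelOp μ (indicatorConstLp 2 hs hμs.ne c) u,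
        indicatorConstLp_coeFn (p := 2) (hs := hs) (hμs := hμs.ne) (c := c),
        indicatorConstLp_coeFn (p := 2) (hs := hs) (hμs := hμs.ne) (c := (1 : ℂ)),
        Lp.coeFn_smul (c u) (indicatorConstLp 2 hs hμs.ne (1 : ℂ))] with z h1 h2 h3 h4
      rw [h1, h2, h4, Pi.smul_apply, h3]
      by_cases hz : z ∈ s <;> simp [hz]
    rw [e]
    exact (isCompactOperator_of_locallyCompactSpace_dom c).clm_comp
      (ContinuousLinearMap.toSpanSingleton ℂ (indicatorConstLp 2 hs hμs.ne (1 : ℂ)))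
  · intro f g hf hg _ h1 h2
    rw [map_add]
    exact h1.add h2
  · exact isClosed_setOfPred_isCompactOperator.preimage (kernelOp μ).continuous

/-! ### Young's inequality -/

/-- Cauchy–Schwarz applied to √g · (√g v). -/
theorem lintegral_mul_sq_le {X : Type*} [MeasurableSpace X] {μ : Measure X} {g v : X → ENNReal}
    (hg : AEMeasurable g μ) (hv : AEMeasurable v μ) :
    (∫⁻ x, g x * v x ∂μ) ^ 2 ≤ (∫⁻ x, g x ∂μ) * ∫⁻ x, g x * v x ^ 2 ∂μ := by
  have hsq : ∀ x : ENNReal, (x ^ (1 / 2 : ℝ)) ^ 2 = x := fun x => by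
    rw [← ENNReal.rpow_natCast, ← ENNReal.rpow_mul]
    simp
  have h := ENNReal.lintegral_mul_le_Lp_mul_Lq μ (Real.HolderConjugate.two_two)
    (hg.pow_const (1 / 2 : ℝ)) ((hg.pow_const (1 / 2 : ℝ)).mul hv)
  simp only [Pi.mul_apply, ← mul_assoc, ← sq, hsq, ENNReal.rpow_ofNat, mul_pow] at h
  calc _ ≤ _ := pow_le_pow_left₀ (zero_le) h 2
    _ = _ := by rw [mul_pow, hsq, hsq]

theorem lintegral_conv_sq_le {n : ℕ} {g v : Cn n → ENNReal} (hg : Measurable g)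
    (hv : AEMeasurable v) :
    ∫⁻ z, (∫⁻ w, g (w - z) * v w) ^ 2 ≤ (∫⁻ w, g w) ^ 2 * ∫⁻ w, v w ^ 2 := by
  have h1 : ∀ z : Cn n, (∫⁻ w, g (w - z) * v w) ^ 2 ≤
      (∫⁻ w, g w) * ∫⁻ w, g (w - z) * v w ^ 2 := by
    intro z
    have h2 := lintegral_mul_sq_le (μ := (volume : Measure (Cn n)))
      (hg.comp (measurable_id.sub_const z)).aemeasurable hv
    simp only [Function.comp_apply, id_eq] at h2
    rwa [lintegral_sub_right_eq_self] at h2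
  have hm : AEMeasurable (Function.uncurry fun z w : Cn n => g (w - z) * v w ^ 2)
      (volume.prod volume) :=
    (hg.comp (measurable_snd.sub measurable_fst)).aemeasurable.mul
      ((hv.comp_quasiMeasurePreserving Measure.quasiMeasurePreserving_snd).pow_const 2)
  have hm2 : AEMeasurable fun z : Cn n => ∫⁻ w, g (w - z) * v w ^ 2 := hm.lintegral_prod_right'
  calc _ ≤ ∫⁻ z, (∫⁻ w, g w) * ∫⁻ w, g (w - z) * v w ^ 2 := lintegral_mono h1
    _ = (∫⁻ w, g w) * ∫⁻ z, ∫⁻ w, g (w - z) * v w ^ 2 := lintegral_const_mul'' _ hm2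
    _ = (∫⁻ w, g w) * ∫⁻ w, ∫⁻ z, g (w - z) * v w ^ 2 := by rw [lintegral_lintegral_swap hm]
    _ = (∫⁻ w, g w) * ∫⁻ w, (∫⁻ z, g z) * v w ^ 2 := by
        congr 1
        refine lintegral_congr fun w => ?_
        have hgw : Measurable fun z => g (w - z) := hg.comp (measurable_id.const_sub w)
        rw [lintegral_mul_const _ hgw, lintegral_sub_left_eq_self g w]
    _ = _ := by rw [lintegral_const_mul'' _ (hv.pow_const 2), sq, mul_assoc]

theorem norm_le_of_le_conv {n : ℕ} {G : Cn n → ℝ} (hG : Integrable G) (hG0 : ∀ t, 0 ≤ G t)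
    (hGm : Measurable G) {F u : L2Cn n}
    (h : ∀ᵐ z, ‖F z‖ₑ ≤ ∫⁻ w, ENNReal.ofReal (G (w - z)) * ‖u w‖ₑ) :
    ‖F‖ ≤ (∫ t, G t) * ‖u‖ := by
  have sq_eq : ∀ f : L2Cn n, eLpNorm f 2 volume ^ 2 = ∫⁻ z, ‖f z‖ₑ ^ 2 := by
    intro f
    have := eLpNorm_nnreal_pow_eq_lintegral (μ := volume) (f := f) (p := 2) two_ne_zero
    simpa using this
  have h1 : eLpNorm F 2 volume ^ 2 ≤ (ENNReal.ofReal (∫ t, G t) * eLpNorm u 2 volume) ^ 2 := by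
    rw [mul_pow, sq_eq, sq_eq, ofReal_integral_eq_lintegral_ofReal hG (Eventually.of_forall hG0)]
    refine (lintegral_mono_ae ?_).trans (lintegral_conv_sq_le hGm.ennreal_ofReal
      (Lp.aestronglyMeasurable u).enorm)
    filter_upwards [h] with z hz
    exact pow_le_pow_left₀ zero_le hz 2
  have h2 := (ENNReal.pow_le_pow_left_iff two_ne_zero).1 h1
  rw [Lp.norm_def, Lp.norm_def, ← ENNReal.toReal_ofReal (integral_nonneg hG0), ← ENNReal.toReal_mul]
  exact ENNReal.toReal_mono (ENNReal.mul_ne_top ENNReal.ofReal_ne_top (Lp.eLpNorm_ne_top u)) h2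

/-! ### Vanishing oscillation -/

/-- After scaling by ‖z‖, the difference is z − w plus a radial correction along w, and each has
norm at most ‖z − w‖. -/
theorem norm_unit_sub_unit_le {E : Type*} [NormedAddCommGroup E] [NormedSpace ℝ E] {z w : E}
    (hz : z ≠ 0) (hw : w ≠ 0) : ‖‖z‖⁻¹ • z - ‖w‖⁻¹ • w‖ ≤ 2 * ‖z - w‖ / ‖z‖ := by
  have hz' := norm_pos_iff.2 hz
  have hw' := norm_pos_iff.2 hw
  have h1 : ‖z‖⁻¹ • z - ‖w‖⁻¹ • w = ‖z‖⁻¹ • ((z - w) + (1 - ‖z‖ * ‖w‖⁻¹) • w) := by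
    rw [sub_smul, smul_add, smul_sub, smul_sub, smul_smul ‖z‖⁻¹ (_ * _), ← mul_assoc,
      inv_mul_cancel₀ hz'.ne', one_smul, one_mul]
    abel
  have h2 : ‖(1 - ‖z‖ * ‖w‖⁻¹) • w‖ ≤ ‖z - w‖ := by
    have h3 : |1 - ‖z‖ * ‖w‖⁻¹| * ‖w‖ = |‖w‖ - ‖z‖| := by
      rw [← abs_of_pos hw', ← abs_mul, abs_of_pos hw']
      congr 1
      field_simp
    rw [norm_smul, Real.norm_eq_abs, h3, abs_sub_comm]
    exact abs_norm_sub_norm_le z w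
  rw [h1, norm_smul, norm_inv, norm_norm, inv_mul_eq_div]
  gcongr
  linarith [norm_add_le (z - w) ((1 - ‖z‖ * ‖w‖⁻¹) • w)]

/-- Far out, points at distance at most R have nearly equal directions, and `a` is close to its
uniformly continuous boundary value `b` there: three errors of ε/3. -/
theorem exists_oscillation_le {n : ℕ} {a : Cn n →ᵇ ℂ} (ha : a ∈ radialAlgebra n) {ε : ℝ}
    (hε : 0 < ε) (R : ℝ) : ∃ M : ℝ, ∀ z w, M < ‖z‖ → ‖w - z‖ ≤ R → ‖a w - a z‖ ≤ ε := by
  obtain ⟨b, hb⟩ := ha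
  obtain ⟨δ, hδ, hbδ⟩ := Metric.uniformContinuous_iff.1
    (CompactSpace.uniformContinuous_of_continuous b.continuous) (ε / 3) (by positivity)
  obtain ⟨r, hr⟩ := eventually_atTop.1 (Metric.tendstoUniformly_iff.1 hb (ε / 3) (by positivity))
  have key : ∀ z : Cn n, r ≤ ‖z‖ → ∀ hz : z ≠ 0,
      dist (b ⟨‖z‖⁻¹ • z, by simp [norm_smul, hz]⟩) (a z) < ε / 3 := by
    intro z h1 hz
    have h2 := hr ‖z‖ h1 ⟨‖z‖⁻¹ • z, by simp [norm_smul, hz]⟩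
    simpa only [smul_smul, mul_inv_cancel₀ (norm_ne_zero_iff.2 hz), one_smul] using h2
  -- The first bound keeps w nonzero and beyond r, the second does so for z, and the third makes the
  -- directions δ-close.
  refine ⟨max (max r 0 + R) (max (max r 0) (2 * R / δ)), fun z w hM hR => ?_⟩
  have hR0 : 0 ≤ R := (norm_nonneg _).trans hR
  obtain ⟨h1, h2⟩ := max_lt_iff.1 hM
  obtain ⟨h3, h4⟩ := max_lt_iff.1 h2
  obtain ⟨h5, h6⟩ := max_lt_iff.1 h3
  have h7 : max r 0 < ‖w‖ := by
    have := norm_sub_norm_le z w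
    rw [norm_sub_rev] at this
    linarith
  obtain ⟨h8, h9⟩ := max_lt_iff.1 h7
  have hz : z ≠ 0 := norm_pos_iff.1 h6
  have hw : w ≠ 0 := norm_pos_iff.1 h9
  have e1 := key z h5.le hz
  have e2 := key w h8.le hw
  have e3 := @hbδ ⟨‖z‖⁻¹ • z, by simp [norm_smul, hz]⟩ ⟨‖w‖⁻¹ • w, by simp [norm_smul, hw]⟩ (by
    rw [Subtype.dist_eq, dist_eq_norm]
    refine (norm_unit_sub_unit_le hz hw).trans_lt ?_
    rw [div_lt_iff₀ h6, norm_sub_rev]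
    rw [div_lt_iff₀ hδ] at h4
    nlinarith)
  rw [← dist_eq_norm]
  rw [dist_comm] at e2
  have t1 := dist_triangle (a w) (b ⟨‖w‖⁻¹ • w, by simp [norm_smul, hw]⟩) (a z)
  have t2 := dist_triangle (b ⟨‖w‖⁻¹ • w, by simp [norm_smul, hw]⟩)
    (b ⟨‖z‖⁻¹ • z, by simp [norm_smul, hz]⟩) (a z)
  rw [dist_comm] at e3
  linarith

/-! ### Compactness of the commutators -/

theorem memLp_indicator_of_isCompact {n : ℕ} {E : Type*} [NormedAddCommGroup E] {f : Cn n → E}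
    (hf : Continuous f) {K : Set (Cn n)} (hK : IsCompact K) (p : ENNReal) :
    MemLp (K.indicator f) p volume := by
  rw [memLp_indicator_iff_restrict hK.measurableSet]
  obtain ⟨C, hC⟩ := hK.exists_bound_of_continuousOn hf.continuousOn
  have : IsFiniteMeasure ((volume : Measure (Cn n)).restrict K) :=
    ⟨by simpa using hK.measure_lt_top⟩
  refine MemLp.of_bound hf.aestronglyMeasurable C ?_
  exact (ae_restrict_iff' hK.measurableSet).2 (Eventually.of_forall hC)

/-- The functionals ⟪K_z, ·⟫, with K_z = `levelVec k z`, depend continuously on z. They are thus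
bounded, and square integrable, over a ball. -/
theorem exists_isCompactOperator_cutoff {n : ℕ} (k : Fin n → ℕ) (M : ℝ) :
    ∃ C : L2Cn n →L[ℂ] L2Cn n, IsCompactOperator C ∧ ∀ u, ∀ᵐ z,
      C u z = (Metric.closedBall (0 : Cn n) M).indicator (fun z => landauProj n k u z) z := by
  have hc : Continuous fun z => innerSL ℂ (levelVec k z) :=
    (innerSL ℂ).continuous.comp (continuous_levelVec k)
  have hΦ : MemLp ((Metric.closedBall (0 : Cn n) M).indicator
      fun z => innerSL ℂ (levelVec k z)) 2 volume :=
    memLp_indicator_of_isCompact hc (isCompact_closedBall 0 M) 2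
  refine ⟨kernelOp volume (hΦ.toLp _), isCompactOperator_kernelOp _ _, fun u => ?_⟩
  filter_upwards [coeFn_kernelOp volume (hΦ.toLp _) u, hΦ.coeFn_toLp, landauProj_ae_eq k u]
    with z h1 h2 h3
  rw [h1, h2]
  by_cases hz : z ∈ Metric.closedBall (0 : Cn n) M
  · simp only [Set.indicator_of_mem hz, h3, innerSL_apply_apply]
  · simp only [Set.indicator_of_notMem hz, zero_apply]

theorem enorm_commutator_le {n : ℕ} (k : Fin n → ℕ) (a : Cn n →ᵇ ℂ) (u : L2Cn n) :
    ∀ᵐ z, ‖landauProj n k (mulOp a u) z - a z * landauProj n k u z‖ₑ ≤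
      ∫⁻ w, ‖originKernel k (w - z)‖ₑ * ‖a w - a z‖ₑ * ‖u w‖ₑ := by
  filter_upwards [landauProj_ae_eq k u, landauProj_ae_eq k (mulOp a u)] with z h1 h2
  rw [h1, h2, inner_levelVec, inner_levelVec, ← integral_const_mul]
  have hi : ∀ v : L2Cn n, Integrable fun w => (starRingEnd ℂ) (levelKernel k z w) * v w :=
    fun v => (memLp_levelKernel k z).star.integrable_mul (Lp.memLp v)
  rw [← integral_sub (hi _) ((hi _).const_mul _)]
  refine (enorm_integral_le_lintegral_enorm _).trans (lintegral_mono_ae ?_)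
  filter_upwards [coeFn_mulOp a u] with w hw
  have e : (starRingEnd ℂ) (levelKernel k z w) * mulOp a u w -
      a z * ((starRingEnd ℂ) (levelKernel k z w) * u w) =
      (starRingEnd ℂ) (levelKernel k z w) * (a w - a z) * u w := by
    rw [hw]
    ring
  have e2 : ‖(starRingEnd ℂ) (levelKernel k z w)‖ₑ = ‖originKernel k (w - z)‖ₑ := by
    rw [← ofReal_norm, ← ofReal_norm, RCLike.norm_conj, levelKernel, norm_magTranslate]
  rw [e, enorm_mul, enorm_mul, e2]

theorem exists_tail_integral_le {E : Type*} [NormedAddCommGroup E] [MeasurableSpace E]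
    [BorelSpace E] {μ : Measure E} {f : E → ℝ} (hf : Integrable f μ) {ε : ℝ} (hε : 0 < ε) :
    ∃ R : ℝ, ∫ t in (Metric.closedBall (0 : E) R)ᶜ, f t ∂μ ≤ ε := by
  have h : Tendsto (fun m : ℕ => ∫ t, (Metric.closedBall (0 : E) m)ᶜ.indicator f t ∂μ) atTop
      (𝓝 (∫ _, (0 : ℝ) ∂μ)) := by
    refine tendsto_integral_of_dominated_convergence (fun t => ‖f t‖)
      (fun m => hf.1.indicator Metric.isClosed_closedBall.measurableSet.compl) hf.norm
      (fun m => Eventually.of_forall fun t => norm_indicator_le_norm_self _ _)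
      (Eventually.of_forall fun t => ?_)
    obtain ⟨N, hN⟩ := exists_nat_ge ‖t‖
    refine tendsto_const_nhds.congr' ?_
    filter_upwards [eventually_ge_atTop N] with m hm
    rw [Set.indicator_of_notMem]
    have : (N : ℝ) ≤ m := by exact_mod_cast hm
    simpa using hN.trans this
  rw [integral_zero] at h
  obtain ⟨m, hm⟩ := (h.eventually (eventually_le_nhds hε)).exists
  refine ⟨m, ?_⟩
  rwa [integral_indicator Metric.isClosed_closedBall.measurableSet.compl] at hm

theorem exists_isCompactOperator_near_commutator {n : ℕ} (k : Fin n → ℕ) {a : Cn n →ᵇ ℂ}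
    (ha : a ∈ radialAlgebra n) {η : ℝ} (hη : 0 < η) :
    ∃ C : L2Cn n →L[ℂ] L2Cn n, IsCompactOperator C ∧
      ‖landauProj n k ∘L mulOp a - mulOp a ∘L landauProj n k - C‖ ≤ η := by
  set J := ∫ t, ‖originKernel k t‖ with hJ
  have hJ0 : 0 ≤ J := integral_nonneg fun t => norm_nonneg _
  have hκ := integrable_originKernel k
  -- R and ε are chosen so that the far and near parts of G each have integral at most η/2; the
  -- added 1 keeps the denominators positive.
  obtain ⟨R, hR⟩ := exists_tail_integral_le hκ.norm (ε := η / (2 * (2 * ‖a‖ + 1))) (by positivity)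
  set ε := η / (2 * (J + 1)) with hε
  have hε0 : 0 < ε := by positivity
  obtain ⟨M, hM⟩ := exists_oscillation_le ha hε0 R
  obtain ⟨C, hC, hCu⟩ := exists_isCompactOperator_cutoff k M
  have hRm : MeasurableSet (Metric.closedBall (0 : Cn n) R)ᶜ :=
    Metric.isClosed_closedBall.measurableSet.compl
  -- Within distance R the oscillation is at most ε; beyond it only the bound 2‖a‖ is available,
  -- against the small tail of κ.
  set G : Cn n → ℝ := fun t => ε * ‖originKernel k t‖ +
    2 * ‖a‖ * (Metric.closedBall (0 : Cn n) R)ᶜ.indicator (fun t => ‖originKernel k t‖) t with hG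
  have hGi : Integrable G := (hκ.norm.const_mul _).add ((hκ.norm.indicator hRm).const_mul _)
  have hG0 : ∀ t, 0 ≤ G t := fun t =>
    add_nonneg (by positivity) (mul_nonneg (by positivity)
      (Set.indicator_nonneg (fun _ _ => norm_nonneg _) _))
  have hGm : Measurable G :=
    ((continuous_originKernel k).norm.measurable.const_mul _).add
      (((continuous_originKernel k).norm.measurable.indicator hRm).const_mul _)
  have hGint : ∫ t, G t ≤ η := by
    rw [hG, integral_add (hκ.norm.const_mul _) ((hκ.norm.indicator hRm).const_mul _),
      integral_const_mul, integral_const_mul, integral_indicator hRm, ← hJ]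
    have h1 : ε * J ≤ η / 2 := by
      rw [hε, div_mul_eq_mul_div, div_le_iff₀ (by positivity)]
      nlinarith
    have h2 : 2 * ‖a‖ * (η / (2 * (2 * ‖a‖ + 1))) ≤ η / 2 := by
      rw [← mul_div_assoc, div_le_iff₀ (by positivity)]
      nlinarith [norm_nonneg a]
    have h3 := mul_le_mul_of_nonneg_left hR (by positivity : 0 ≤ 2 * ‖a‖)
    linarith
  have hGb : ∀ z w, M < ‖z‖ → ‖originKernel k (w - z)‖ * ‖a w - a z‖ ≤ G (w - z) := by
    intro z w hz
    rw [hG]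
    by_cases hw : ‖w - z‖ ≤ R
    · have : w - z ∉ (Metric.closedBall (0 : Cn n) R)ᶜ := by simpa using hw
      simp only [Set.indicator_of_notMem this, mul_zero, add_zero]
      rw [mul_comm]
      exact mul_le_mul_of_nonneg_right (hM z w hz hw) (norm_nonneg _)
    · have : w - z ∈ (Metric.closedBall (0 : Cn n) R)ᶜ := by simpa using hw
      simp only [Set.indicator_of_mem this]
      have h1 : ‖a w - a z‖ ≤ 2 * ‖a‖ := by
        rw [← dist_eq_norm]
        exact a.dist_le_two_norm w z
      have h2 := mul_le_mul_of_nonneg_left h1 (norm_nonneg (originKernel k (w - z)))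
      have h3 : 0 ≤ ε * ‖originKernel k (w - z)‖ := by positivity
      linarith
  -- C is the projection followed by the cutoff to the ball. The cutoff commutes with multiplication
  -- by `a`, so the remainder is the commutator cut off to |z| > M.
  refine ⟨C ∘L mulOp a - mulOp a ∘L C, (hC.comp_clm (mulOp a)).sub (hC.clm_comp (mulOp a)), ?_⟩
  refine ContinuousLinearMap.opNorm_le_bound _ hη.le fun u => ?_
  refine (norm_le_of_le_conv hGi hG0 hGm ?_).trans
    (mul_le_mul_of_nonneg_right hGint (norm_nonneg u))
  simp only [sub_apply, ContinuousLinearMap.comp_apply]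
  filter_upwards [enorm_commutator_le k a u, hCu u, hCu (mulOp a u),
    Lp.coeFn_sub (landauProj n k (mulOp a u) - mulOp a (landauProj n k u))
      (C (mulOp a u) - mulOp a (C u)),
    Lp.coeFn_sub (landauProj n k (mulOp a u)) (mulOp a (landauProj n k u)),
    Lp.coeFn_sub (C (mulOp a u)) (mulOp a (C u)), coeFn_mulOp a (landauProj n k u),
    coeFn_mulOp a (C u)] with z h1 h2 h3 h4 h5 h6 h7 h8
  rw [h4, Pi.sub_apply, h5, h6, Pi.sub_apply, Pi.sub_apply, h7, h8, h2, h3]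
  by_cases hz : z ∈ Metric.closedBall (0 : Cn n) M
  · simp only [Set.indicator_of_mem hz, sub_self, enorm_zero, zero_le]
  · simp only [Set.indicator_of_notMem hz, mul_zero, sub_zero]
    refine h1.trans (lintegral_mono fun w => ?_)
    gcongr
    rw [← ofReal_norm, ← ofReal_norm, ← ENNReal.ofReal_mul (norm_nonneg _)]
    exact ENNReal.ofReal_le_ofReal (hGb z w (by simpa using hz))

theorem isCompactOperator_commutator {n : ℕ} (k : Fin n → ℕ) {a : Cn n →ᵇ ℂ}
    (ha : a ∈ radialAlgebra n) :
    IsCompactOperator (landauProj n k ∘L multRep n a - multRep n a ∘L landauProj n k) := by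
  change IsCompactOperator (landauProj n k ∘L mulOp a - mulOp a ∘L landauProj n k)
  have h : landauProj n k ∘L mulOp a - mulOp a ∘L landauProj n k ∈
      closure {C : L2Cn n →L[ℂ] L2Cn n | IsCompactOperator C} := by
    refine Metric.mem_closure_iff.2 fun ε hε => ?_
    obtain ⟨C, hC, hle⟩ := exists_isCompactOperator_near_commutator k ha (half_pos hε)
    exact ⟨C, hC, by rw [dist_eq_norm]; linarith⟩
  rwa [isClosed_setOfPred_isCompactOperator.closure_eq] at h

/-! ### Toeplitz operators on the level -/

theorem inner_mulOp {n : ℕ} (a : Cn n →ᵇ ℂ) (f g : L2Cn n) :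
    inner ℂ (mulOp (star a) f) g = inner ℂ f (mulOp a g) := by
  rw [L2.inner_def, L2.inner_def]
  refine integral_congr_ae ?_
  filter_upwards [coeFn_mulOp (star a) f, coeFn_mulOp a g] with z h1 h2
  rw [h1, h2]
  simp only [RCLike.inner_apply, BoundedContinuousFunction.star_apply, map_mul, Complex.star_def,
    Complex.conj_conj]
  ring

theorem mulOp_mul {n : ℕ} (a b : Cn n →ᵇ ℂ) (f : L2Cn n) :
    mulOp (a * b) f = mulOp a (mulOp b f) := by
  refine Lp.ext ?_
  filter_upwards [coeFn_mulOp (a * b) f, coeFn_mulOp a (mulOp b f), coeFn_mulOp b f]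
    with z h1 h2 h3
  rw [h1, h2, h3, BoundedContinuousFunction.mul_apply, mul_assoc]

theorem toeplitz_star {n : ℕ} (k : Fin n → ℕ) (a : Cn n →ᵇ ℂ) :
    toeplitz n k (star a) = ContinuousLinearMap.adjoint (toeplitz n k a) := by
  rw [ContinuousLinearMap.eq_adjoint_iff]
  intro f g
  change inner ℂ ((landauLevel n k).orthogonalProjectionOnto (mulOp (star a) f)) g =
    inner ℂ f ((landauLevel n k).orthogonalProjectionOnto (mulOp a g))
  rw [Submodule.inner_orthogonalProjectionOnto_eq_of_mem_right,
    Submodule.inner_orthogonalProjectionOnto_eq_of_mem_left, inner_mulOp]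

/-- On the level Pf = f, so P a b f − P a P b f = −P a [P, b] f, and the compact commutator of b
makes the whole compact. -/
theorem isCompactOperator_semicommutator {n : ℕ} (k : Fin n → ℕ) (a : Cn n →ᵇ ℂ) {b : Cn n →ᵇ ℂ}
    (hb : b ∈ radialAlgebra n) :
    IsCompactOperator (toeplitz n k (a * b) - toeplitz n k a ∘L toeplitz n k b) := by
  have e : toeplitz n k (a * b) - toeplitz n k a ∘L toeplitz n k b =
      -((landauLevel n k).orthogonalProjectionOnto ∘L mulOp a ∘L
        (landauProj n k ∘L multRep n b - multRep n b ∘L landauProj n k) ∘L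
        (landauLevel n k).subtypeL) := by
    ext1 f
    have hf : landauProj n k (f : L2Cn n) = f :=
      Submodule.starProjection_eq_self_iff.2 f.2
    change (landauLevel n k).orthogonalProjectionOnto (mulOp (a * b) f) -
      (landauLevel n k).orthogonalProjectionOnto (mulOp a (landauProj n k (mulOp b f))) =
      -((landauLevel n k).orthogonalProjectionOnto (mulOp a
        (landauProj n k (mulOp b f) - mulOp b (landauProj n k f))))
    rw [hf, mulOp_mul, map_sub, map_sub, neg_sub]
  rw [e]
  exact ((((isCompactOperator_commutator k hb).comp_clm (landauLevel n k).subtypeL).clm_comp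
    (mulOp a)).clm_comp (landauLevel n k).orthogonalProjectionOnto).neg

end LandauLevels

end

theorem mainTheorem5 (n : ℕ) (k : Fin n → ℕ) :
    (∀ a ∈ LandauLevels.radialAlgebra n,
      IsCompactOperator
        (LandauLevels.landauProj n k ∘L LandauLevels.multRep n a -
          LandauLevels.multRep n a ∘L LandauLevels.landauProj n k)) ∧
    (∀ a ∈ LandauLevels.radialAlgebra n,
      LandauLevels.toeplitz n k (star a) =
        ContinuousLinearMap.adjoint (LandauLevels.toeplitz n k a)) ∧
    (∀ a ∈ LandauLevels.radialAlgebra n, ∀ b ∈ LandauLevels.radialAlgebra n,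
      IsCompactOperator
        (LandauLevels.toeplitz n k (a * b) -
          LandauLevels.toeplitz n k a ∘L LandauLevels.toeplitz n k b)) :=
  ⟨fun _ ha => LandauLevels.isCompactOperator_commutator k ha,
    fun a _ => LandauLevels.toeplitz_star k a,
    fun a _ _ hb => LandauLevels.isCompactOperator_semicommutator k a hb⟩
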